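/- Let $H$ be a separable real Hilbert space, let $\mathcal L_S(H)$ be the space of bounded self-adjoint operators on $H$ with the operator norm, and let $\Phi_S(H)\subset\mathcal L_S(H)$ be the set of Fredholm operators in it (closed image, finite-dimensional kernel). For $T,S\in\mathcal L_S(H)$ write $S\le T$ if $\langle (T-S)h,h\rangle\ge 0$ for all $h\in H$. Paths are norm-continuous maps on a compact interval $I=[a,b]$. *Spectral flow.* For $T\in\mathcal L_S(H)$ let $E^+(T)$ and $E^-(T)$ be the spectral subspaces of $T$ belonging to $(0,\infty)$ and $(-\infty,0)$, i.e. the largest $T$-invariant subspaces on which $\langle Tx,x\rangle$ is positive definite, respectively negative definite. For invertible $S,T\in\mathcal L_S(H)$ with $S-T$ compact put $$\mu_{rel}(S,T)=\dim\big(E^-(S)\cap E^+(T)\big)-\dim\big(E^-(T)\cap E^+(S)\big)\in\mathbb Z .$$ A cogredient parametrix of a path $L\colon I\to\Phi_S(H)$ with respect to a symmetry $J$ (that is, $J=J^*$ and $J^2=\mathrm{Id}$) is a path $N\colon I\to GL(H)$ such that $N_\lambda^*L_\lambda N_\lambda=J+K_\lambda$ with $K_\lambda$ compact for every $\lambda\in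 I$. If $L_a$ and $L_b$ are invertible, then $\operatorname{sf}(L)=\mu_{rel}(J+K_a,J+K_b)$ for any symmetry $J$ and any cogredient parametrix of $L$ with respect to $J$. For a general path $L\colon I\to\Phi_S(H)$, $\operatorname{sf}(L)=\operatorname{sf}(L+\delta\,\mathrm{Id})$ for all sufficiently small $\delta>0$. **Statement.** Let $L,M\colon[a,b]\to\Phi_S(H)$ be paths such that $L_\lambda-M_\lambda$ is compact for each $\lambda\in[a,b]$. If $L_a\le M_a$ and $M_b\le L_b$, then the spectral flows of $M$ and $L$ are well defined (exactly one integer arises from the above definition in each case), and $$\operatorname{sf}(M)\le\operatorname{sf}(L).$$ -/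

import Mathlib

open Set Topology

/-- `Φ_S(H)`: the bounded self-adjoint Fredholm operators on the real Hilbert space `H`. -/
def selfAdjointFredholm (H : Type*) [NormedAddCommGroup H] [InnerProductSpace ℝ H]
    [CompleteSpace H] : Set (H →L[ℝ] H) :=
  {T | IsSelfAdjoint T ∧ T.IsFredholm}

section SpectralFlow

variable {H : Type*} [NormedAddCommGroup H] [InnerProductSpace ℝ H]

/-- `E⁺(T)`: the largest `T`-invariant subspace on which the quadratic form `⟨T x, x⟩` is positive
definite. For a bounded self-adjoint `T` this is the spectral subspace of `T` belonging to
`(0, ∞)`, which contains every other invariant subspace of this kind. -/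
def positiveSpace (T : H →L[ℝ] H) : Submodule ℝ H :=
  sSup {V : Submodule ℝ H | (∀ x ∈ V, T x ∈ V) ∧ ∀ x ∈ V, x ≠ 0 → 0 < inner ℝ (T x) x}

/-- `E⁻(T)`: the largest `T`-invariant subspace on which the quadratic form `⟨T x, x⟩` is negative
definite. For a bounded self-adjoint `T` this is the spectral subspace of `T` belonging to
`(-∞, 0)`. -/
def negativeSpace (T : H →L[ℝ] H) : Submodule ℝ H :=
  sSup {V : Submodule ℝ H | (∀ x ∈ V, T x ∈ V) ∧ ∀ x ∈ V, x ≠ 0 → inner ℝ (T x) x < 0}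

/-- The relative Morse index
`μ_rel(S, T) = dim (E⁻(S) ∩ E⁺(T)) - dim (E⁻(T) ∩ E⁺(S))`. Both dimensions are finite when `S` and
`T` are invertible, self-adjoint and differ by a compact operator, the only case that is used. -/
noncomputable def relMorseIndex (S T : H →L[ℝ] H) : ℤ :=
  (Module.finrank ℝ (negativeSpace S ⊓ positiveSpace T : Submodule ℝ H) : ℤ) -
    (Module.finrank ℝ (negativeSpace T ⊓ positiveSpace S : Submodule ℝ H) : ℤ)

variable [CompleteSpace H]

/-- `N`, restricted to `[a, b]`, is a cogredient parametrix of the path `L` with respect to `J`: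
a norm-continuous path in `GL(H)` such that `N_t* L_t N_t = J + K_t` with `K_t` compact. -/
structure IsCogredientParametrix (a b : ℝ) (L : ℝ → H →L[ℝ] H) (J : H →L[ℝ] H)
    (N : ℝ → H →L[ℝ] H) : Prop where
  continuousOn : ContinuousOn N (Icc a b)
  isUnit : ∀ t ∈ Icc a b, IsUnit (N t)
  isCompact : ∀ t ∈ Icc a b,
    IsCompactOperator (ContinuousLinearMap.adjoint (N t) ∘L L t ∘L N t - J)

/-- The integer `n` is the spectral flow on `[a, b]` of the admissible path `L` (invertible
end-points): `n = μ_rel(J + K_a, J + K_b)` for some cogredient parametrix `N` of `L`,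
`N_t* L_t N_t = J + K_t`, with respect to some symmetry `J = J*`, `J² = Id`.

No condition is put on the eigenspaces of `J`, so that all components of `Φ_S(H)`, and
finite-dimensional `H`, are treated at once. If `L` is strongly indefinite, then both eigenspaces
of `J` are forced to be infinite-dimensional, and `J` is a polarization. If the `L_t` are
essentially positive (negative), then `N ⊕ Id` is a cogredient parametrix of `L ⊕ ∓Id` on
`H ⊕ H` with respect to `J ⊕ ∓Id`, with the same relative Morse index. -/
def HasAdmissibleSpectralFlow (a b : ℝ) (L : ℝ → H →L[ℝ] H) (n : ℤ) : Prop :=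
  IsUnit (L a) ∧ IsUnit (L b) ∧
    ∃ (J : H →L[ℝ] H) (N : ℝ → H →L[ℝ] H),
      IsSelfAdjoint J ∧ J ∘L J = ContinuousLinearMap.id ℝ H ∧ IsCogredientParametrix a b L J N ∧
        n = relMorseIndex (ContinuousLinearMap.adjoint (N a) ∘L L a ∘L N a)
          (ContinuousLinearMap.adjoint (N b) ∘L L b ∘L N b)

/-- The integer `n` is the (extended) spectral flow on `[a, b]` of the path `L`, whose end-points
need not be invertible: it is the spectral flow of the admissible path `L + δ Id`, for all
sufficiently small `δ > 0`. -/
def HasSpectralFlow (a b : ℝ) (L : ℝ → H →L[ℝ] H) (n : ℤ) : Prop :=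
  ∀ᶠ δ : ℝ in 𝓝[>] 0,
    HasAdmissibleSpectralFlow a b (fun t => L t + δ • ContinuousLinearMap.id ℝ H) n

/-- The spectral flow `sf(L, [a, b])`, the integer singled out by `HasSpectralFlow`. -/
noncomputable def spectralFlow (a b : ℝ) (L : ℝ → H →L[ℝ] H) : ℤ :=
  Classical.epsilon fun n => HasSpectralFlow a b L n

end SpectralFlow

/-! A cogredient parametrix `N` of `L` with respect to `J` is also one of `M`, because `N*(L - M)N`
is compact. Put `A = N*LN` and `B = N*MN`; all values lie in `J` + compact. For invertible
end-points, additivity of μ = μ_rel on this class gives sf(L) = μ(A_a, A_b) = μ(A_a, B_a) + μ(B_a,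
B_b) + μ(B_b, A_b), whose middle term is sf(M). The outer terms are nonnegative: if S ≤ T, no
nonzero vector lies in E⁻(T) ∩ E⁺(S) (`relMorseIndex_nonneg`). For general end-points, the same
small δ Id is added to both paths, which changes no difference.

The work lies in additivity and in well-definedness. Both use that μ is locally constant
(`eventually_relMorseIndex_eq`). Indeed E⁺(T) and E⁻(T) are the eigenspaces of the symmetry T|T|⁻¹,
which depends continuously on T and changes by a compact operator when T does; for symmetries the
index is stable because closed direct sum decompositions are (`eventually_symIndex_eq`). Square
roots near the identity, obtained by a convergent iteration, replace the functional calculus.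

Additivity (`relMorseIndex_add_relMorseIndex`) is reduced by approximation to finite-rank
perturbations of `J`, where it is a dimension count. A parametrix exists because (1 + JE)^(-1/2)
carries J + E to J for small E, and local parametrices can be glued. The flow is independent of the
parametrix because a homotopy reduces the change to one constant cogredience `U`, and polar
decomposition deforms `U` to a multiple of an orthogonal operator (`relMorseIndex_conj`). -/

set_option linter.unusedSectionVars false

/-! ### Square roots near the identity in a Banach algebra. -/

section SquareRoot

open Filter

lemma norm_mul_self_sub_le {A : Type*} [NormedRing A] {u v : A} {r : ℝ} (hu : ‖u‖ ≤ r)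
    (hv : ‖v‖ ≤ r) :
    ‖u * u - v * v‖ ≤ 2 * r * ‖u - v‖ := by
  have h : u * u - v * v = u * (u - v) + (u - v) * v := by noncomm_ring
  rw [h]
  have h1 := norm_add_le (u * (u - v)) ((u - v) * v)
  have h2 := norm_mul_le u (u - v)
  have h3 := norm_mul_le (u - v) v
  have h4 := mul_le_mul_of_nonneg_right hu (norm_nonneg (u - v))
  have h5 := mul_le_mul_of_nonneg_left hv (norm_nonneg (u - v))
  linarith

variable {A : Type*} [NormedRing A] [NormedAlgebra ℝ A]

/-- Iterates converging to the solution `y` of `(1 - y) ^ 2 = 1 - x`. -/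
noncomputable def sqrtIter (x : A) : ℕ → A
  | 0 => 0
  | n + 1 => (1 / 2 : ℝ) • (x + sqrtIter x n * sqrtIter x n)

/-- `1 - sqrtDefect x` is a square root of `1 - x` when `‖x‖ < 1`. -/
noncomputable def sqrtDefect (x : A) : A := limUnder atTop (sqrtIter x)

lemma norm_sqrtIter_le {x : A} (hx : ‖x‖ ≤ 1) (n : ℕ) : ‖sqrtIter x n‖ ≤ ‖x‖ := by
  induction n with
  | zero => simp [sqrtIter]
  | succ n ih =>
    have h := norm_mul_le (sqrtIter x n) (sqrtIter x n)
    have h2 := norm_add_le x (sqrtIter x n * sqrtIter x n)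
    rw [sqrtIter, norm_smul, Real.norm_eq_abs, abs_of_pos (by norm_num)]
    nlinarith [norm_nonneg (sqrtIter x n), norm_nonneg x]

/-- The bound is the fixed point of `d ↦ (‖x - x'‖ + 2 r d) / 2`, which controls one iteration step
on the ball of radius `r`. Being uniform in `n`, it passes to the limit and gives continuity of
`sqrtDefect`. -/
lemma norm_sqrtIter_sub_le {x x' : A} {r : ℝ} (hr : r < 1) (hx : ‖x‖ ≤ r) (hx' : ‖x'‖ ≤ r)
    (n : ℕ) : ‖sqrtIter x n - sqrtIter x' n‖ ≤ ‖x - x'‖ / (2 * (1 - r)) := by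
  have hpos : 0 < 2 * (1 - r) := by linarith
  have hr0 : 0 ≤ r := (norm_nonneg x).trans hx
  induction n with
  | zero => simp only [sqrtIter, sub_self, norm_zero]; positivity
  | succ n ih =>
    have h := norm_mul_self_sub_le ((norm_sqrtIter_le (hx.trans hr.le) n).trans hx)
      ((norm_sqrtIter_le (hx'.trans hr.le) n).trans hx')
    have e : sqrtIter x (n + 1) - sqrtIter x' (n + 1) = (1 / 2 : ℝ) • ((x - x') +
        (sqrtIter x n * sqrtIter x n - sqrtIter x' n * sqrtIter x' n)) := by
      simp only [sqrtIter]; module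
    rw [e, norm_smul, Real.norm_eq_abs, abs_of_pos (by norm_num)]
    have h2 := norm_add_le (x - x') (sqrtIter x n * sqrtIter x n - sqrtIter x' n * sqrtIter x' n)
    have h3 : ‖x - x'‖ = ‖x - x'‖ / (2 * (1 - r)) * (2 * (1 - r)) :=
      (div_mul_cancel₀ _ hpos.ne').symm
    have h4 := mul_le_mul_of_nonneg_left ih (by linarith : 0 ≤ 2 * r)
    nlinarith

lemma norm_sqrtIter_succ_sub_le {x : A} (hx : ‖x‖ < 1) (n : ℕ) :
    ‖sqrtIter x (n + 1) - sqrtIter x n‖ ≤ ‖x‖ * ‖x‖ ^ n := by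
  induction n with
  | zero =>
    simp only [sqrtIter, mul_zero, add_zero, sub_zero, pow_zero, mul_one]
    rw [norm_smul, Real.norm_eq_abs, abs_of_pos (by norm_num)]
    linarith [norm_nonneg x]
  | succ n ih =>
    have h := norm_mul_self_sub_le (norm_sqrtIter_le hx.le (n + 1)) (norm_sqrtIter_le hx.le n)
    have e : sqrtIter x (n + 1 + 1) - sqrtIter x (n + 1) = (1 / 2 : ℝ) •
        (sqrtIter x (n + 1) * sqrtIter x (n + 1) - sqrtIter x n * sqrtIter x n) := by
      conv_lhs => rw [sqrtIter]
      conv_lhs => enter [2]; rw [sqrtIter]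
      module
    rw [e, norm_smul, Real.norm_eq_abs, abs_of_pos (by norm_num), pow_succ]
    have h4 := mul_le_mul_of_nonneg_left ih (norm_nonneg x)
    nlinarith

variable [CompleteSpace A]

lemma tendsto_sqrtIter {x : A} (hx : ‖x‖ < 1) :
    Tendsto (sqrtIter x) atTop (𝓝 (sqrtDefect x)) := by
  refine CauchySeq.tendsto_limUnder (cauchySeq_of_le_geometric ‖x‖ ‖x‖ hx fun n => ?_)
  rw [dist_comm, dist_eq_norm]
  exact norm_sqrtIter_succ_sub_le hx n

lemma norm_sqrtDefect_le {x : A} (hx : ‖x‖ < 1) : ‖sqrtDefect x‖ ≤ ‖x‖ :=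
  le_of_tendsto (tendsto_sqrtIter hx).norm (Eventually.of_forall (norm_sqrtIter_le hx.le))

lemma one_sub_sqrtDefect_mul_self {x : A} (hx : ‖x‖ < 1) :
    (1 - sqrtDefect x) * (1 - sqrtDefect x) = 1 - x := by
  have h1 := (tendsto_add_atTop_iff_nat 1).2 (tendsto_sqrtIter hx)
  have h2 : Tendsto (fun n => sqrtIter x (n + 1)) atTop
      (𝓝 ((1 / 2 : ℝ) • (x + sqrtDefect x * sqrtDefect x))) :=
    (((tendsto_sqrtIter hx).mul (tendsto_sqrtIter hx)).const_add x).const_smul _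
  have h3 : (2 : ℝ) • sqrtDefect x = x + sqrtDefect x * sqrtDefect x := by
    conv_lhs => rw [tendsto_nhds_unique h1 h2]
    rw [smul_smul]; norm_num
  have h4 : sqrtDefect x * sqrtDefect x = (2 : ℝ) • sqrtDefect x - x := by rw [h3]; abel
  have h5 : (1 - sqrtDefect x) * (1 - sqrtDefect x) =
      1 - (2 : ℝ) • sqrtDefect x + sqrtDefect x * sqrtDefect x := by
    rw [two_smul]; noncomm_ring
  rw [h5, h4]; abel

lemma isUnit_one_sub_smul_sqrtDefect {x : A} (hx : ‖x‖ < 1) {s : ℝ} (hs : s ∈ Icc (0 : ℝ) 1) :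
    IsUnit (1 - s • sqrtDefect x) := by
  refine isUnit_one_sub_of_norm_lt_one ?_
  rw [norm_smul, Real.norm_eq_abs, abs_of_nonneg hs.1]
  exact lt_of_le_of_lt (mul_le_of_le_one_left (norm_nonneg _) hs.2)
    ((norm_sqrtDefect_le hx).trans_lt hx)

lemma isUnit_one_sub_sqrtDefect {x : A} (hx : ‖x‖ < 1) : IsUnit (1 - sqrtDefect x) := by
  simpa using isUnit_one_sub_smul_sqrtDefect hx (s := 1) (by simp)

lemma continuousAt_sqrtDefect {x : A} (hx : ‖x‖ < 1) : ContinuousAt (sqrtDefect : A → A) x := by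
  obtain ⟨r, hxr, hr⟩ := exists_between hx
  have hev : ∀ᶠ x' in 𝓝 x, ‖x'‖ ≤ r :=
    (continuous_norm.continuousAt.eventually_lt continuousAt_const hxr).mono fun _ h => h.le
  have hb : ∀ᶠ x' in 𝓝 x, ‖sqrtDefect x' - sqrtDefect x‖ ≤ ‖x' - x‖ / (2 * (1 - r)) := by
    filter_upwards [hev] with x' hx'
    exact le_of_tendsto
      ((tendsto_sqrtIter (hx'.trans_lt hr)).sub (tendsto_sqrtIter hx)).norm
      (Eventually.of_forall (norm_sqrtIter_sub_le hr hx' hxr.le))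
  rw [ContinuousAt, tendsto_iff_norm_sub_tendsto_zero]
  refine squeeze_zero' (Eventually.of_forall fun _ => norm_nonneg _) hb ?_
  have : Continuous fun x' : A => ‖x' - x‖ / (2 * (1 - r)) := by fun_prop
  simpa using this.tendsto x

/-- A closed set containing `0` and stable under `y ↦ (x + y²) / 2` contains `sqrtDefect x`. -/
lemma sqrtDefect_mem {x : A} (hx : ‖x‖ < 1) {C : Set A} (hC : IsClosed C) (h0 : (0 : A) ∈ C)
    (hs : ∀ y ∈ C, (1 / 2 : ℝ) • (x + y * y) ∈ C) : sqrtDefect x ∈ C := by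
  refine hC.mem_of_tendsto (tendsto_sqrtIter hx) (Eventually.of_forall fun n => ?_)
  induction n with
  | zero => exact h0
  | succ n ih => exact hs _ ih

/-- A closed relation containing `(0, 0)` and stable under the iteration step relates
`sqrtDefect x` and `sqrtDefect x'`. -/
lemma sqrtDefect_rel {x x' : A} (hx : ‖x‖ < 1) (hx' : ‖x'‖ < 1) {C : Set (A × A)}
    (hC : IsClosed C) (h0 : (0, 0) ∈ C)
    (hs : ∀ y y', (y, y') ∈ C → ((1 / 2 : ℝ) • (x + y * y), (1 / 2 : ℝ) • (x' + y' * y')) ∈ C) :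
    (sqrtDefect x, sqrtDefect x') ∈ C := by
  refine hC.mem_of_tendsto ((tendsto_sqrtIter hx).prodMk_nhds (tendsto_sqrtIter hx'))
    (Eventually.of_forall fun n => ?_)
  induction n with
  | zero => exact h0
  | succ n ih => exact hs _ _ ih

lemma sqrtDefect_commute {x c : A} (hx : ‖x‖ < 1) (hc : Commute c x) :
    Commute c (sqrtDefect x) := by
  have hC : IsClosed {y : A | c * y = y * c} := isClosed_eq (by fun_prop) (by fun_prop)
  refine sqrtDefect_mem hx hC (by simp) fun y hy => ?_
  have hy' : Commute c y := hy
  exact (hc.add_right (hy'.mul_right hy')).smul_right _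

lemma star_sqrtDefect [StarRing A] [ContinuousStar A] [StarModule ℝ A] {x x' : A}
    (hx : ‖x‖ < 1) (hx' : ‖x'‖ < 1) (h : star x = x') :
    star (sqrtDefect x) = sqrtDefect x' := by
  refine sqrtDefect_rel hx hx' (C := {p : A × A | star p.1 = p.2})
    (isClosed_eq (by fun_prop) (by fun_prop)) (by simp) fun y y' hy => ?_
  have hy : star y = y' := hy
  simp [h, hy]

/-- Conjugation by an involution is an algebra automorphism, so it commutes with the iteration. -/
lemma conj_sqrtDefect {x x' J : A} (hJ : J * J = 1) (hx : ‖x‖ < 1) (hx' : ‖x'‖ < 1)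
    (h : J * x * J = x') : J * sqrtDefect x * J = sqrtDefect x' := by
  refine sqrtDefect_rel hx hx' (C := {p : A × A | J * p.1 * J = p.2})
    (isClosed_eq (by fun_prop) (by fun_prop)) (by simp) fun y y' hy => ?_
  have hy : J * y * J = y' := hy
  have e : J * (y * y) * J = (J * y * J) * (J * y * J) := by
    calc J * (y * y) * J = J * y * 1 * (y * J) := by noncomm_ring
      _ = _ := by rw [← hJ]; noncomm_ring
  simp only [mem_ofPred_eq, mul_smul_comm, smul_mul_assoc, mul_add, add_mul, h, e, hy]

end SquareRoot

/-! ### Absolute value and sign of an invertible self-adjoint operator. -/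

section SpectralSymmetry

open Filter ContinuousLinearMap

variable {H : Type*} [NormedAddCommGroup H] [InnerProductSpace ℝ H] [CompleteSpace H]

lemma inner_apply_left_of_isSelfAdjoint {T : H →L[ℝ] H} (hT : IsSelfAdjoint T) (x y : H) :
    inner ℝ (T x) y = inner ℝ x (T y) := by
  have := adjoint_inner_left T y x
  rwa [← star_eq_adjoint, hT.star_eq] at this

lemma exists_bound_below_of_isUnit {T : H →L[ℝ] H} (hT : IsUnit T) :
    ∃ m > 0, ∀ x, m * ‖x‖ ≤ ‖T x‖ := by
  obtain ⟨u, rfl⟩ := hT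
  set S : H →L[ℝ] H := ((u⁻¹ : (H →L[ℝ] H)ˣ) : H →L[ℝ] H)
  refine ⟨(‖S‖ + 1)⁻¹, by positivity, fun x => ?_⟩
  have h : S ((u : H →L[ℝ] H) x) = x := by
    change (S * (u : H →L[ℝ] H)) x = x
    simp [S]
  have h1 := S.le_opNorm ((u : H →L[ℝ] H) x)
  rw [h] at h1
  rw [inv_mul_le_iff₀ (by positivity)]
  nlinarith [norm_nonneg ((u : H →L[ℝ] H) x)]

/-- Expanding `‖x - c⁻² T*T x‖²` and using `‖T*T x‖ ≤ c ‖T x‖` leaves at most `‖x‖² - c⁻² ‖T x‖²`,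
and `T` is bounded below. This brings `T*T`, suitably scaled, into the range of the square root
iteration. -/
lemma norm_one_sub_star_mul_lt {c : ℝ} {T : H →L[ℝ] H} (hc : 0 < c) (hle : ‖T‖ ≤ c)
    (hu : IsUnit T) : ‖(1 - (c⁻¹ * c⁻¹) • (star T * T) : H →L[ℝ] H)‖ < 1 := by
  obtain ⟨m, hm, hb⟩ := exists_bound_below_of_isUnit hu
  set D : H →L[ℝ] H := 1 - (c⁻¹ * c⁻¹) • (star T * T) with hD
  have key : ∀ x, ‖D x‖ ^ 2 ≤ (1 - (m / c) ^ 2) * ‖x‖ ^ 2 := by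
    intro x
    have e : D x = x - (c⁻¹ * c⁻¹) • star T (T x) := by simp [hD]
    have h1 : inner ℝ x (star T (T x)) = ‖T x‖ ^ 2 := by
      rw [star_eq_adjoint, adjoint_inner_right, real_inner_self_eq_norm_sq]
    rw [e, norm_sub_sq_real, inner_smul_right, h1, norm_smul, Real.norm_eq_abs,
      abs_of_pos (by positivity), mul_pow]
    have h2 : ‖star T (T x)‖ ≤ c * ‖T x‖ :=
      ((star T).le_opNorm _).trans
        (mul_le_mul_of_nonneg_right ((norm_star T).trans_le hle) (norm_nonneg _))
    have h3 : ‖star T (T x)‖ ^ 2 ≤ (c * ‖T x‖) ^ 2 := pow_le_pow_left₀ (norm_nonneg _) h2 2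
    have h4 : (m * ‖x‖) ^ 2 ≤ ‖T x‖ ^ 2 := pow_le_pow_left₀ (by positivity) (hb x) 2
    have h5 := mul_le_mul_of_nonneg_left h3 (by positivity : 0 ≤ (c⁻¹ * c⁻¹) ^ 2)
    have h6 := mul_le_mul_of_nonneg_left h4 (by positivity : 0 ≤ (c⁻¹ * c⁻¹))
    have h7 : (c⁻¹ * c⁻¹) ^ 2 * (c * ‖T x‖) ^ 2 = (c⁻¹ * c⁻¹) * ‖T x‖ ^ 2 := by field_simp
    have h8 : (c⁻¹ * c⁻¹) * (m * ‖x‖) ^ 2 = (m / c) ^ 2 * ‖x‖ ^ 2 := by field_simp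
    linarith
  -- On the zero space `m` may exceed `c`; the cut-off at `0` keeps the root below meaningful.
  set q := max 0 (1 - (m / c) ^ 2)
  have hq : q < 1 := max_lt one_pos (by have : 0 < (m / c) ^ 2 := by positivity
                                        linarith)
  have hq0 : 0 ≤ q := le_max_left _ _
  refine lt_of_le_of_lt (opNorm_le_bound _ (Real.sqrt_nonneg q) fun x => ?_)
    ((Real.sqrt_lt' one_pos).2 (by simpa using hq))
  refine abs_le_of_sq_le_sq' ?_ (by positivity) |>.2
  rw [mul_pow, Real.sq_sqrt hq0]
  exact (key x).trans (mul_le_mul_of_nonneg_right (le_max_right _ _) (by positivity))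

/-- `1 - T² / c²`. -/
noncomputable def sqDefect (c : ℝ) (T : H →L[ℝ] H) : H →L[ℝ] H := 1 - (c⁻¹ * c⁻¹) • (T * T)

/-- The absolute value `√(T²)` of a self-adjoint invertible operator `T` with `‖T‖ ≤ c`. -/
noncomputable def absOp (c : ℝ) (T : H →L[ℝ] H) : H →L[ℝ] H :=
  c • (1 - sqrtDefect (sqDefect c T))

/-- The symmetry `T |T|⁻¹` of a self-adjoint invertible operator `T` with `‖T‖ ≤ c`. -/
noncomputable def signOp (c : ℝ) (T : H →L[ℝ] H) : H →L[ℝ] H := T * Ring.inverse (absOp c T)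

/-- Self-adjoint invertible operators of norm at most `c`. -/
structure IsRegularOp (c : ℝ) (T : H →L[ℝ] H) : Prop where
  pos : 0 < c
  norm_le : ‖T‖ ≤ c
  isSelfAdjoint : IsSelfAdjoint T
  isUnit : IsUnit T

namespace IsRegularOp

variable {c : ℝ} {T : H →L[ℝ] H} (h : IsRegularOp c T)
include h

lemma norm_sqDefect_lt : ‖sqDefect c T‖ < 1 := by
  have := norm_one_sub_star_mul_lt h.pos h.norm_le h.isUnit
  rwa [h.isSelfAdjoint.star_eq] at this

lemma absOp_mul_self : absOp c T * absOp c T = T * T := by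
  have hc := h.pos.ne'
  rw [absOp, smul_mul_smul_comm, one_sub_sqrtDefect_mul_self h.norm_sqDefect_lt, sqDefect,
    sub_sub_cancel, smul_smul]
  rw [show c * c * (c⁻¹ * c⁻¹) = 1 by field_simp, one_smul]

lemma isUnit_absOp : IsUnit (absOp c T) :=
  (isUnit_one_sub_sqrtDefect h.norm_sqDefect_lt).smul (Units.mk0 c h.pos.ne')

lemma commute_absOp {B : H →L[ℝ] H} (hB : Commute B T) : Commute B (absOp c T) :=
  ((Commute.one_right B).sub_right (sqrtDefect_commute h.norm_sqDefect_lt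
    ((Commute.one_right B).sub_right ((hB.mul_right hB).smul_right _)))).smul_right _

lemma isSelfAdjoint_absOp : IsSelfAdjoint (absOp c T) := by
  have hT := h.isSelfAdjoint.star_eq
  have : star (sqrtDefect (sqDefect c T)) = sqrtDefect (sqDefect c T) :=
    star_sqrtDefect h.norm_sqDefect_lt h.norm_sqDefect_lt (by simp [sqDefect, hT])
  simp [IsSelfAdjoint, absOp, this]

lemma absOp_coercive : ∃ k > 0, ∀ x, k * ‖x‖ ^ 2 ≤ inner ℝ (absOp c T x) x := by
  refine ⟨c * (1 - ‖sqDefect c T‖), mul_pos h.pos (sub_pos.2 h.norm_sqDefect_lt), fun x => ?_⟩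
  have e : absOp c T x = c • (x - sqrtDefect (sqDefect c T) x) := by simp [absOp]
  rw [e, real_inner_smul_left, inner_sub_left, real_inner_self_eq_norm_sq, mul_assoc]
  refine mul_le_mul_of_nonneg_left ?_ h.pos.le
  have h1 := real_inner_le_norm (sqrtDefect (sqDefect c T) x) x
  have h2 := (sqrtDefect (sqDefect c T)).le_opNorm x
  have h3 := norm_sqrtDefect_le h.norm_sqDefect_lt
  have h4 := mul_le_mul_of_nonneg_right h2 (norm_nonneg x)
  have h5 := mul_le_mul_of_nonneg_right h3 (sq_nonneg ‖x‖)
  nlinarith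

lemma absOp_pos {x : H} (hx : x ≠ 0) : 0 < inner ℝ (absOp c T x) x := by
  obtain ⟨k, hk, hb⟩ := h.absOp_coercive
  have := hb x
  have : 0 < k * ‖x‖ ^ 2 := by have := norm_pos_iff.2 hx; positivity
  linarith

/-- The absolute value maps a `T`-invariant subspace to its closure. -/
lemma absOp_mem_closure {V : Submodule ℝ H} (hV : ∀ x ∈ V, T x ∈ V) {x : H} (hx : x ∈ V) :
    absOp c T x ∈ V.topologicalClosure := by
  have hT : ∀ x ∈ V.topologicalClosure, T x ∈ V.topologicalClosure := fun x hx =>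
    map_mem_closure (s := (V : Set H)) T.continuous hx hV
  -- The operators preserving the closure of `V` form a closed set stable under the iteration.
  -- Closure is needed because limits of vectors of `V` appear.
  have hmem : sqrtDefect (sqDefect c T) ∈
      {B : H →L[ℝ] H | ∀ x ∈ V.topologicalClosure, B x ∈ V.topologicalClosure} := by
    refine sqrtDefect_mem h.norm_sqDefect_lt ?_ ?_ ?_
    · simp only [ofPred_forall]
      exact isClosed_iInter fun x => isClosed_iInter fun _ =>
        V.isClosed_topologicalClosure.preimage
          (f := fun B : H →L[ℝ] H => B x) (by fun_prop)
    · exact fun x _ => by simp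
    · intro y hy x hx
      simp only [sqDefect, smul_apply, add_apply, sub_apply]
      exact Submodule.smul_mem _ _ (add_mem (sub_mem hx (Submodule.smul_mem _ _
        (hT _ (hT _ hx)))) (hy _ (hy _ hx)))
  have hx' := V.le_topologicalClosure hx
  exact Submodule.smul_mem _ _ (sub_mem hx' (hmem x hx'))

/-- The kernel of `T + |T|` is itself an admissible subspace. Conversely, for `x` in an admissible
`V`, the vector `z = T x + |T| x` lies in the closure of `V`, where the form is nonpositive, while
`T z = |T| z` makes `⟨T z, z⟩` positive unless `z = 0`. -/
lemma mem_negativeSpace {x : H} : x ∈ negativeSpace T ↔ T x = -absOp c T x := by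
  have hcomm : Commute T (absOp c T) := h.commute_absOp (Commute.refl T)
  have hcomm' : ∀ y, T (absOp c T y) = absOp c T (T y) := fun y =>
    congrArg (fun A : H →L[ℝ] H => A y) hcomm.eq
  constructor
  · suffices negativeSpace T ≤ LinearMap.ker ((T + absOp c T : H →L[ℝ] H) : H →ₗ[ℝ] H) by
      intro hx
      have := this hx
      rw [LinearMap.mem_ker] at this
      exact eq_neg_of_add_eq_zero_left this
    refine sSup_le ?_
    rintro V ⟨hV, hneg⟩ x hx
    set z := T x + absOp c T x with hz
    have hzV : z ∈ V.topologicalClosure :=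
      add_mem (V.le_topologicalClosure (hV x hx)) (h.absOp_mem_closure hV hx)
    have hle : inner ℝ (T z) z ≤ 0 := by
      have hcl : IsClosed {y : H | inner ℝ (T y) y ≤ 0} :=
        isClosed_le (by fun_prop) continuous_const
      refine closure_minimal (s := (V : Set H)) (fun y hy => ?_) hcl hzV
      by_cases h0 : y = 0
      · simp [h0]
      · exact (hneg y hy h0).le
    have hTz : T z = absOp c T z := by
      have h2 : T (T x) = absOp c T (absOp c T x) :=
        congrArg (fun A : H →L[ℝ] H => A x) h.absOp_mul_self.symm
      simp only [hz, map_add, h2, hcomm' x]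
      abel
    rw [LinearMap.mem_ker]
    change z = 0
    by_contra h0
    have := h.absOp_pos h0
    rw [hTz] at hle
    linarith
  · intro hx
    refine (le_sSup (a := LinearMap.ker ((T + absOp c T : H →L[ℝ] H) : H →ₗ[ℝ] H)) ?_ :
      _ ≤ negativeSpace T) ?_
    · refine ⟨fun y hy => ?_, fun y hy h0 => ?_⟩
      · have hy : T y + absOp c T y = 0 := hy
        change T (T y) + absOp c T (T y) = 0
        rw [← hcomm', ← map_add, hy, map_zero]
      · have hy : T y + absOp c T y = 0 := hy
        rw [eq_neg_of_add_eq_zero_left hy, inner_neg_left]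
        exact neg_neg_of_pos (h.absOp_pos h0)
    · change T x + absOp c T x = 0
      rw [hx, neg_add_cancel]

lemma neg : IsRegularOp c (-T) :=
  ⟨h.pos, by simpa using h.norm_le, h.isSelfAdjoint.neg, h.isUnit.neg⟩

end IsRegularOp

omit [CompleteSpace H] in
lemma negativeSpace_neg (T : H →L[ℝ] H) : negativeSpace (-T) = positiveSpace T := by
  unfold negativeSpace positiveSpace
  congr 1
  ext V
  simp

namespace IsRegularOp

variable {c : ℝ} {T : H →L[ℝ] H} (h : IsRegularOp c T)
include h

lemma mem_positiveSpace {x : H} : x ∈ positiveSpace T ↔ T x = absOp c T x := by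
  rw [← negativeSpace_neg, h.neg.mem_negativeSpace]
  simp [absOp, sqDefect]

lemma inner_neg {x : H} (hx : x ∈ negativeSpace T) (h0 : x ≠ 0) : inner ℝ (T x) x < 0 := by
  rw [h.mem_negativeSpace.1 hx, inner_neg_left]
  exact neg_neg_of_pos (h.absOp_pos h0)

lemma inner_pos {x : H} (hx : x ∈ positiveSpace T) (h0 : x ≠ 0) : 0 < inner ℝ (T x) x := by
  rw [h.mem_positiveSpace.1 hx]
  exact h.absOp_pos h0

end IsRegularOp

/-- A symmetry: `J = J*` and `J² = 1`. -/
structure IsSymmetry (J : H →L[ℝ] H) : Prop where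
  isSelfAdjoint : IsSelfAdjoint J
  mul_self : J * J = 1

namespace IsRegularOp

variable {c : ℝ} {T : H →L[ℝ] H} (h : IsRegularOp c T)
include h

lemma signOp_mul_absOp : signOp c T * absOp c T = T := by
  rw [signOp, mul_assoc, Ring.inverse_mul_cancel _ h.isUnit_absOp, mul_one]

lemma commute_inverse {B : H →L[ℝ] H} (hB : Commute B T) :
    Commute B (Ring.inverse (absOp c T)) := by
  have hc := h.commute_absOp hB
  obtain ⟨u, hu⟩ := h.isUnit_absOp
  rw [← hu, Ring.inverse_unit]
  exact Commute.units_inv_right (hu ▸ hc)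

lemma isSymmetry_signOp : IsSymmetry (signOp c T) := by
  have hc := h.commute_inverse (Commute.refl T)
  constructor
  · have h1 : star (Ring.inverse (absOp c T)) = Ring.inverse (absOp c T) := by
      rw [← Ring.inverse_star, h.isSelfAdjoint_absOp.star_eq]
    rw [IsSelfAdjoint, signOp, star_mul, h1, h.isSelfAdjoint.star_eq, hc.eq]
  · have hu := h.isUnit_absOp
    calc signOp c T * signOp c T
        = (T * T) * (Ring.inverse (absOp c T) * Ring.inverse (absOp c T)) := by
          simp only [signOp, mul_assoc]
          rw [← mul_assoc _ T, ← hc.eq]; simp only [mul_assoc]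
      _ = (absOp c T * (absOp c T * Ring.inverse (absOp c T))) * Ring.inverse (absOp c T) := by
          rw [← h.absOp_mul_self]; simp only [mul_assoc]
      _ = 1 := by rw [Ring.mul_inverse_cancel _ hu, mul_one, Ring.mul_inverse_cancel _ hu]

lemma injective_absOp : Function.Injective (absOp c T) :=
  (ContinuousLinearMap.isUnit_iff_bijective.1 h.isUnit_absOp).1

lemma mem_negativeSpace_iff_signOp {x : H} : x ∈ negativeSpace T ↔ signOp c T x = -x := by
  have hc : Commute (signOp c T) (absOp c T) :=
    h.commute_absOp ((Commute.refl T).mul_left (h.commute_inverse (Commute.refl T)).symm)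
  rw [h.mem_negativeSpace]
  have e : T x = absOp c T (signOp c T x) := by
    conv_lhs => rw [← h.signOp_mul_absOp, hc.eq]
    rfl
  rw [e, ← map_neg, h.injective_absOp.eq_iff]

lemma mem_positiveSpace_iff_signOp {x : H} : x ∈ positiveSpace T ↔ signOp c T x = x := by
  rw [← negativeSpace_neg, h.neg.mem_negativeSpace_iff_signOp]
  simp [signOp, absOp, sqDefect]

lemma continuousAt_signOp : ContinuousAt (signOp c : (H →L[ℝ] H) → H →L[ℝ] H) T := by
  have h1 : ContinuousAt (fun S : H →L[ℝ] H => sqrtDefect (sqDefect c S)) T :=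
    ContinuousAt.comp (f := sqDefect c) (continuousAt_sqrtDefect h.norm_sqDefect_lt)
      (by unfold sqDefect; fun_prop)
  have h2 : ContinuousAt (absOp c : (H →L[ℝ] H) → H →L[ℝ] H) T := by
    unfold absOp; fun_prop
  obtain ⟨u, hu⟩ := h.isUnit_absOp
  have h3 : ContinuousAt (fun S => Ring.inverse (absOp c S) : (H →L[ℝ] H) → H →L[ℝ] H) T := by
    refine ContinuousAt.comp (g := Ring.inverse) ?_ h2
    rw [← hu]
    exact NormedRing.inverse_continuousAt u
  exact continuousAt_id.mul h3

end IsRegularOp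

lemma isClosed_compact_sub :
    IsClosed {p : (H →L[ℝ] H) × (H →L[ℝ] H) | IsCompactOperator (p.1 - p.2)} :=
  (isClosed_setOfPred_isCompactOperator (σ₁₂ := RingHom.id ℝ) (M₁ := H) (M₂ := H)).preimage
    (f := fun p : (H →L[ℝ] H) × (H →L[ℝ] H) => p.1 - p.2) (by fun_prop)

lemma isCompactOperator_mul_sub {A A' B B' : H →L[ℝ] H} (hA : IsCompactOperator (A - A'))
    (hB : IsCompactOperator (B - B')) : IsCompactOperator (A * B - A' * B') := by
  have e : A * B - A' * B' = (A - A') * B + A' * (B - B') := by noncomm_ring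
  rw [e]
  exact (hA.comp_clm B).add (hB.clm_comp A')

lemma isCompactOperator_inverse_sub {A B : H →L[ℝ] H} (hA : IsUnit A) (hB : IsUnit B)
    (h : IsCompactOperator (A - B)) : IsCompactOperator (Ring.inverse A - Ring.inverse B) := by
  have e : Ring.inverse A - Ring.inverse B = -(Ring.inverse A * ((A - B) * Ring.inverse B)) := by
    have h1 : Ring.inverse A * ((A - B) * Ring.inverse B) =
      (Ring.inverse A * A) * Ring.inverse B - Ring.inverse A * (B * Ring.inverse B) := by
        noncomm_ring
    rw [h1, Ring.inverse_mul_cancel _ hA, Ring.mul_inverse_cancel _ hB]; simp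
  rw [e]
  exact ((h.comp_clm (Ring.inverse B)).clm_comp (Ring.inverse A)).neg

/-- Having compact difference is a closed relation preserved by sums, products and inverses, hence
by the square root iteration. -/
lemma IsRegularOp.isCompactOperator_signOp_sub {c : ℝ} {S T : H →L[ℝ] H} (hS : IsRegularOp c S)
    (hT : IsRegularOp c T) (h : IsCompactOperator (S - T)) :
    IsCompactOperator (signOp c S - signOp c T) := by
  have hsq : IsCompactOperator (sqDefect c S - sqDefect c T) := by
    have e : sqDefect c S - sqDefect c T = -((c⁻¹ * c⁻¹) • (S * S - T * T)) := by
      simp only [sqDefect]; module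
    rw [e]
    exact ((isCompactOperator_mul_sub h h).smul (c⁻¹ * c⁻¹)).neg
  have hd : IsCompactOperator (sqrtDefect (sqDefect c S) - sqrtDefect (sqDefect c T)) := by
    refine sqrtDefect_rel hS.norm_sqDefect_lt hT.norm_sqDefect_lt isClosed_compact_sub
      (by simpa using isCompactOperator_zero) fun y y' hy => ?_
    have e : (1 / 2 : ℝ) • (sqDefect c S + y * y) - (1 / 2 : ℝ) • (sqDefect c T + y' * y') =
        (1 / 2 : ℝ) • ((sqDefect c S - sqDefect c T) + (y * y - y' * y')) := by module
    simp only [mem_ofPred_eq, e]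
    exact (hsq.add (isCompactOperator_mul_sub hy hy)).smul (1 / 2 : ℝ)
  have habs : IsCompactOperator (absOp c S - absOp c T) := by
    have e : absOp c S - absOp c T =
        -(c • (sqrtDefect (sqDefect c S) - sqrtDefect (sqDefect c T))) := by
      simp only [absOp]; module
    rw [e]
    exact (hd.smul c).neg
  exact isCompactOperator_mul_sub h
    (isCompactOperator_inverse_sub hS.isUnit_absOp hT.isUnit_absOp habs)

end SpectralSymmetry

/-! ### Linear algebra of pairs of subspaces. -/

section SubspacePairs

variable {E : Type*} [AddCommGroup E] [Module ℝ E]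

lemma finrank_map_eq_of_disjoint_ker {E' : Type*} [AddCommGroup E'] [Module ℝ E']
    (f : E →ₗ[ℝ] E') {W : Submodule ℝ E} (h : Disjoint W (LinearMap.ker f)) :
    Module.finrank ℝ (W.map f) = Module.finrank ℝ W := by
  have hinj : Function.Injective (f.domRestrict W) := by
    rw [← LinearMap.ker_eq_bot, LinearMap.ker_eq_bot']
    intro x hx
    have : (x : E) ∈ W ⊓ LinearMap.ker f := ⟨x.2, hx⟩
    rw [h.eq_bot, Submodule.mem_bot] at this
    exact Subtype.ext this
  rw [← LinearMap.finrank_range_of_inj hinj, LinearMap.range_domRestrict]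

/-- If `V = Z ⊕ F`, and `C` and `D` are complements of `Z ⊕ P` and of `V + P`, then
`dim (V ∩ P) - dim D = dim F - dim C`. -/
lemma finrank_inf_add_finrank_compl {V P Z F C D : Submodule ℝ E} [FiniteDimensional ℝ F]
    [FiniteDimensional ℝ C] (hV : Z ⊔ F = V) (hZF : Disjoint Z F) (hZP : Disjoint Z P)
    (hC : IsCompl (Z ⊔ P) C) (hD : IsCompl (V ⊔ P) D) :
    Module.finrank ℝ (V ⊓ P : Submodule ℝ E) + Module.finrank ℝ C =
      Module.finrank ℝ F + Module.finrank ℝ D := by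
  set Y := Z ⊔ P
  have hVP : Y ⊔ F = V ⊔ P := by rw [← hV]; simp only [Y]; rw [sup_right_comm]
  -- Both subspaces meet `Z` trivially and have the same image modulo `Z`.
  have e1 : Module.finrank ℝ (V ⊓ P : Submodule ℝ E) = Module.finrank ℝ (F ⊓ Y : Submodule ℝ E) := by
    have h : (V ⊓ P).map Z.mkQ = (F ⊓ Y).map Z.mkQ := by
      apply le_antisymm
      · rintro _ ⟨x, ⟨hxV, hxP⟩, rfl⟩
        rw [← hV] at hxV
        obtain ⟨z, hz, f, hf, rfl⟩ := Submodule.mem_sup.1 hxV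
        refine ⟨f, ⟨hf, Submodule.mem_sup.2 ⟨-z, neg_mem hz, z + f, hxP, by abel⟩⟩, ?_⟩
        rw [map_add, (Submodule.Quotient.mk_eq_zero Z).2 hz |> (fun h => (h : Z.mkQ z = 0)), zero_add]
      · rintro _ ⟨f, ⟨hf, hfY⟩, rfl⟩
        obtain ⟨z, hz, p, hp, rfl⟩ := Submodule.mem_sup.1 hfY
        refine ⟨p, ⟨?_, hp⟩, ?_⟩
        · rw [← hV]
          exact Submodule.mem_sup.2 ⟨-z, neg_mem hz, z + p, hf, by abel⟩
        · rw [map_add, (Submodule.Quotient.mk_eq_zero Z).2 hz |> (fun h => (h : Z.mkQ z = 0)),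
            zero_add]
    rw [← finrank_map_eq_of_disjoint_ker Z.mkQ (W := V ⊓ P), h,
      finrank_map_eq_of_disjoint_ker Z.mkQ]
    · rw [Submodule.ker_mkQ]; exact (hZF.mono_right inf_le_left).symm
    · rw [Submodule.ker_mkQ]; exact (hZP.mono_right inf_le_right).symm
  have e2 := LinearMap.finrank_range_add_finrank_ker (Y.mkQ.domRestrict F)
  have e3 : Module.finrank ℝ (LinearMap.ker (Y.mkQ.domRestrict F)) =
      Module.finrank ℝ (F ⊓ Y : Submodule ℝ E) := by
    have : LinearMap.ker (Y.mkQ.domRestrict F) = Y.comap F.subtype := by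
      ext x; simp [LinearMap.mem_ker]
    rw [this, ← Submodule.finrank_map_subtype_eq, Submodule.map_comap_subtype]
  have eC := (Submodule.quotientEquivOfIsCompl Y C hC).finrank_eq
  have eD := (Submodule.quotientEquivOfIsCompl (V ⊔ P) D hD).finrank_eq
  have : FiniteDimensional ℝ (E ⧸ Y) :=
    (Submodule.quotientEquivOfIsCompl Y C hC).symm.finiteDimensional
  -- Dimension count in `E / Y`, of dimension `dim C`: the subspace `(V + P) / Y` is the image of
  -- `F`, with kernel `F ∩ Y`, and the quotient by it has dimension `dim D`.
  have e4 := Submodule.finrank_quotient_add_finrank (((V ⊔ P).map Y.mkQ : Submodule ℝ (E ⧸ Y)))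
  have e5 := (Submodule.quotientQuotientEquivQuotient Y (V ⊔ P)
    (hVP ▸ le_sup_left)).finrank_eq
  have e6 : (V ⊔ P).map Y.mkQ = LinearMap.range (Y.mkQ.domRestrict F) := by
    rw [LinearMap.range_domRestrict, ← hVP, Submodule.map_sup, Submodule.mkQ_map_self, bot_sup_eq]
  rw [e5, e6] at e4
  omega

end SubspacePairs

/-! ### Pairs of symmetries with compact difference; stability of their index. -/

section SymmetryPairs

open Filter ContinuousLinearMap

variable {H : Type*} [NormedAddCommGroup H] [InnerProductSpace ℝ H] [CompleteSpace H]

/-- The `-1`-eigenspace. -/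
def eigNeg (σ : H →L[ℝ] H) : Submodule ℝ H where
  carrier := {x | σ x = -x}
  add_mem' {x y} hx hy := by
    simp only [mem_ofPred_eq] at *
    rw [map_add, hx, hy]; abel
  zero_mem' := by simp
  smul_mem' c x hx := by
    simp only [mem_ofPred_eq] at *
    rw [map_smul, hx, smul_neg]

/-- The `1`-eigenspace. -/
def eigPos (σ : H →L[ℝ] H) : Submodule ℝ H where
  carrier := {x | σ x = x}
  add_mem' {x y} hx hy := by
    simp only [mem_ofPred_eq] at *
    rw [map_add, hx, hy]
  zero_mem' := by simp
  smul_mem' c x hx := by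
    simp only [mem_ofPred_eq] at *
    rw [map_smul, hx]

lemma mem_eigNeg {σ : H →L[ℝ] H} {x : H} : x ∈ eigNeg σ ↔ σ x = -x := Iff.rfl

lemma mem_eigPos {σ : H →L[ℝ] H} {x : H} : x ∈ eigPos σ ↔ σ x = x := Iff.rfl

/-- `dim (ker (σ + 1) ∩ ker (τ - 1)) - dim (ker (τ + 1) ∩ ker (σ - 1))`. -/
noncomputable def symIndex (σ τ : H →L[ℝ] H) : ℤ :=
  (Module.finrank ℝ (eigNeg σ ⊓ eigPos τ : Submodule ℝ H) : ℤ) -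
    (Module.finrank ℝ (eigNeg τ ⊓ eigPos σ : Submodule ℝ H) : ℤ)

lemma finiteDimensional_of_compact {K : H →L[ℝ] H} (hK : IsCompactOperator K) {μ : ℝ}
    (hμ : μ ≠ 0) {W : Submodule ℝ H} (hW : ∀ x ∈ W, K x = μ • x) : FiniteDimensional ℝ W := by
  set N := LinearMap.ker ((K - μ • ContinuousLinearMap.id ℝ H : H →L[ℝ] H) : H →ₗ[ℝ] H)
  have hN : ∀ x ∈ N, K x = μ • x := fun x hx => sub_eq_zero.1 hx
  have hWN : W ≤ N := fun x hx => sub_eq_zero.2 (hW x hx)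
  have hcl : IsClosed (N : Set H) :=
    ContinuousLinearMap.isClosed_ker (K - μ • ContinuousLinearMap.id ℝ H)
  have : CompleteSpace N := hcl.completeSpace_coe
  have hinv : ∀ x ∈ N, (K : H →ₗ[ℝ] H) x ∈ N := fun x hx => by
    change K x ∈ N
    rw [hN x hx]; exact N.smul_mem _ hx
  have h1 := (IsCompactOperator.restrict' (f := (K : H →ₗ[ℝ] H)) hK hinv).smul μ⁻¹
  have h2 : (μ⁻¹ • ⇑((K : H →ₗ[ℝ] H).restrict hinv) : N → N) = id := by
    ext x
    change μ⁻¹ • K x = x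
    rw [hN x x.2, smul_smul, inv_mul_cancel₀ hμ, one_smul]
  rw [h2] at h1
  have := FiniteDimensional.of_isCompactOperator_id (𝕜 := ℝ) h1
  exact Submodule.finiteDimensional_of_le hWN

lemma isCompactOperator_starProjection (D : Submodule ℝ H) [FiniteDimensional ℝ D]
    [D.HasOrthogonalProjection] : IsCompactOperator D.starProjection := by
  have : ProperSpace D := FiniteDimensional.proper ℝ D
  have h1 : IsCompactOperator (D.subtypeL : D → H) :=
    isCompactOperator_of_locallyCompactSpace_rng D.subtypeL
  exact h1.comp_clm D.orthogonalProjectionOnto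

namespace IsSymmetry

variable {σ τ : H →L[ℝ] H}

lemma apply_apply (hσ : IsSymmetry σ) (x : H) : σ (σ x) = x :=
  congrArg (fun A : H →L[ℝ] H => A x) hσ.mul_self

lemma norm_apply (hσ : IsSymmetry σ) (x : H) : ‖σ x‖ = ‖x‖ := by
  have : ‖σ x‖ ^ 2 = ‖x‖ ^ 2 := by
    rw [← real_inner_self_eq_norm_sq, inner_apply_left_of_isSelfAdjoint hσ.isSelfAdjoint,
      hσ.apply_apply, real_inner_self_eq_norm_sq]
  exact (sq_eq_sq₀ (norm_nonneg _) (norm_nonneg _)).1 this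

lemma inner_eq_zero (hσ : IsSymmetry σ) {x y : H} (hx : x ∈ eigNeg σ) (hy : y ∈ eigPos σ) :
    inner ℝ x y = 0 := by
  have h := inner_apply_left_of_isSelfAdjoint hσ.isSelfAdjoint x y
  rw [mem_eigNeg.1 hx, mem_eigPos.1 hy, inner_neg_left] at h
  linarith

lemma sub_mem_eigNeg (hσ : IsSymmetry σ) (x : H) : (1 / 2 : ℝ) • (x - σ x) ∈ eigNeg σ := by
  rw [mem_eigNeg, map_smul, map_sub, hσ.apply_apply]; module

lemma add_mem_eigPos (hσ : IsSymmetry σ) (x : H) : (1 / 2 : ℝ) • (x + σ x) ∈ eigPos σ := by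
  rw [mem_eigPos, map_smul, map_add, hσ.apply_apply]; module

lemma finiteDimensional_inf (h : IsCompactOperator (σ - τ)) :
    FiniteDimensional ℝ (eigNeg σ ⊓ eigPos τ : Submodule ℝ H) := by
  refine finiteDimensional_of_compact h (μ := -2) (by norm_num) fun x hx => ?_
  change σ x - τ x = _
  rw [mem_eigNeg.1 hx.1, mem_eigPos.1 hx.2]; module

/-- Orthogonality is immediate; the point is that the sum is everything. The operator `1 + (τ - σ)/2
= (1 - σ)/2 + (1 + τ)/2` maps into `eigNeg σ ⊔ eigPos τ`, is a compact perturbation of the identity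
and has kernel `D`. Adding the projection onto `D` makes it injective, hence surjective by the
Fredholm alternative. -/
lemma isCompl_sup (hσ : IsSymmetry σ) (hτ : IsSymmetry τ) (h : IsCompactOperator (σ - τ)) :
    IsCompl (eigNeg σ ⊔ eigPos τ) (eigNeg τ ⊓ eigPos σ) := by
  set D := eigNeg τ ⊓ eigPos σ with hD
  have h' : IsCompactOperator (τ - σ) := by simpa using h.neg
  have hfin : FiniteDimensional ℝ D := finiteDimensional_inf h'
  have hort : D ≤ (eigNeg σ ⊔ eigPos τ)ᗮ := by
    intro d hd
    rw [Submodule.mem_orthogonal]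
    intro y hy
    obtain ⟨v, hv, p, hp, rfl⟩ := Submodule.mem_sup.1 hy
    rw [inner_add_left, hσ.inner_eq_zero hv hd.2, real_inner_comm, hτ.inner_eq_zero hd.1 hp,
      add_zero]
  refine ⟨(Submodule.orthogonal_disjoint _).mono_right hort, ?_⟩
  rw [codisjoint_iff, eq_top_iff]
  have : CompleteSpace D := FiniteDimensional.complete ℝ D
  set K : H →L[ℝ] H := (1 / 2 : ℝ) • (τ - σ) + D.starProjection with hK
  have hKc : IsCompactOperator K := by
    exact IsCompactOperator.add (h'.smul (1 / 2 : ℝ)) (isCompactOperator_starProjection D)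
  have hKapp : ∀ x, K x = (1 / 2 : ℝ) • (τ x - σ x) + D.starProjection x := fun x => rfl
  -- Here `σ x = τ x + 2 x`; comparing norms gives `⟨τ x, x⟩ = -‖x‖²`, the equality case of
  -- Cauchy-Schwarz.
  have hDeq : ∀ x, (1 / 2 : ℝ) • (τ x - σ x) = -x → x ∈ D := by
    intro x hx
    have h1 : σ x = τ x + (2 : ℝ) • x := by
      have : τ x - σ x = -((2 : ℝ) • x) := by
        calc τ x - σ x = (2 : ℝ) • ((1 / 2 : ℝ) • (τ x - σ x)) := by module
          _ = _ := by rw [hx]; module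
      rw [sub_eq_iff_eq_add] at this
      rw [this]; abel
    have h2 : ‖τ x + (2 : ℝ) • x‖ ^ 2 = ‖x‖ ^ 2 := by rw [← h1, hσ.norm_apply]
    rw [norm_add_sq_real, hτ.norm_apply, inner_smul_right, norm_smul, Real.norm_eq_abs,
      abs_of_pos (by norm_num : (0 : ℝ) < 2)] at h2
    have h3 : ‖τ x + x‖ ^ 2 = 0 := by
      rw [norm_add_sq_real, hτ.norm_apply]; linarith
    have h4 : τ x = -x := by
      rw [sq_eq_zero_iff, norm_eq_zero] at h3
      exact eq_neg_of_add_eq_zero_left h3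
    exact ⟨h4, mem_eigPos.2 (by rw [h1, h4]; module)⟩
  rcases IsCompactOperator.hasEigenvalue_or_mem_resolventSet hKc (μ := (-1 : ℝ))
    (by norm_num) with he | hr
  · exfalso
    obtain ⟨x, hx⟩ := he.exists_hasEigenvector
    have hx1 : (1 / 2 : ℝ) • (τ x - σ x) + D.starProjection x = -x := by
      rw [← hKapp]
      simpa using hx.apply_eq_smul
    -- Pairing the eigenvalue equation with `d` cancels everything but `⟨d, d⟩`, because `(τ - σ)/2`
    -- is self-adjoint and equals `-1` on `D`.
    set d := D.starProjection x with hd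
    have hdD : d ∈ D := Submodule.starProjection_apply_mem D x
    have h1 : (1 / 2 : ℝ) • (τ d - σ d) = -d := by
      rw [mem_eigNeg.1 hdD.1, mem_eigPos.1 hdD.2]; module
    have h2 : inner ℝ ((1 / 2 : ℝ) • (τ x - σ x)) d = - inner ℝ x d := by
      rw [real_inner_smul_left, inner_sub_left, inner_apply_left_of_isSelfAdjoint hτ.isSelfAdjoint,
        inner_apply_left_of_isSelfAdjoint hσ.isSelfAdjoint, ← inner_sub_right,
        ← real_inner_smul_right, h1, inner_neg_right]
    have h3 : inner ℝ d d = (0 : ℝ) := by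
      have := congrArg (fun z => inner ℝ z d) hx1
      simp only [inner_add_left, inner_neg_left, h2] at this
      linarith
    have h4 : d = 0 := inner_self_eq_zero.1 h3
    rw [h4, add_zero] at hx1
    have h5 := Submodule.starProjection_eq_self_iff.2 (hDeq x hx1)
    exact hx.2 (by rw [← h5, ← hd, h4])
  · intro y _
    have hu : IsUnit (algebraMap ℝ (H →L[ℝ] H) (-1) - K) := hr
    obtain ⟨x, hx⟩ := (ContinuousLinearMap.isUnit_iff_bijective.1 hu).2 (-y)
    have hx' : y = ((1 / 2 : ℝ) • (x - σ x) + (1 / 2 : ℝ) • (x + τ x)) + D.starProjection x := by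
      have h0 : (-1 : ℝ) • x - K x = -y := by rw [← hx]; simp [Algebra.algebraMap_eq_smul_one]
      rw [hKapp] at h0
      rw [← neg_neg y, ← h0]; module
    rw [hx']
    exact Submodule.add_mem_sup (Submodule.add_mem_sup (hσ.sub_mem_eigNeg x) (hτ.add_mem_eigPos x))
      (Submodule.starProjection_apply_mem D x)

/-- The operator `(1 + σ σ₀) / 2` intertwines the symmetries `σ₀` and `σ`. -/
lemma map_eig (hσ : IsSymmetry σ) (hτ : IsSymmetry τ)
    (hu : IsUnit ((1 / 2 : ℝ) • (1 + σ * τ))) :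
    (eigNeg τ).map (((1 / 2 : ℝ) • (1 + σ * τ) : H →L[ℝ] H) : H →ₗ[ℝ] H) = eigNeg σ ∧
      (eigPos τ).map (((1 / 2 : ℝ) • (1 + σ * τ) : H →L[ℝ] H) : H →ₗ[ℝ] H) = eigPos σ := by
  set g : H →L[ℝ] H := (1 / 2 : ℝ) • (1 + σ * τ) with hg
  have happ : ∀ x, g x = (1 / 2 : ℝ) • (x + σ (τ x)) := fun x => rfl
  have hint : ∀ x, σ (g x) = g (τ x) := fun x => by
    rw [happ, happ, map_smul, map_add, hσ.apply_apply, hτ.apply_apply, add_comm]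
  have hbij := ContinuousLinearMap.isUnit_iff_bijective.1 hu
  constructor
  · ext y
    constructor
    · rintro ⟨x, hx, rfl⟩
      change σ (g x) = -g x
      rw [hint, mem_eigNeg.1 hx, map_neg]
    · intro hy
      obtain ⟨x, rfl⟩ := hbij.2 y
      refine ⟨x, ?_, rfl⟩
      rw [mem_eigNeg, hint, ← map_neg] at hy
      exact hbij.1 hy
  · ext y
    constructor
    · rintro ⟨x, hx, rfl⟩
      change σ (g x) = g x
      rw [hint, mem_eigPos.1 hx]
    · intro hy
      obtain ⟨x, rfl⟩ := hbij.2 y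
      refine ⟨x, ?_, rfl⟩
      rw [mem_eigPos, hint] at hy
      exact hbij.1 hy

lemma isClosed_eigPos (σ : H →L[ℝ] H) : IsClosed (eigPos σ : Set H) :=
  isClosed_eq σ.continuous continuous_id

lemma isClosed_eigNeg (σ : H →L[ℝ] H) : IsClosed (eigNeg σ : Set H) :=
  isClosed_eq σ.continuous continuous_neg

end IsSymmetry

/-- A closed direct sum decomposition `H = Z ⊕ P ⊕ C` persists when `Z` and `P` are moved by
operators close to the identity. -/
lemma eventually_isCompl_map {Z P C : Submodule ℝ H} (hZ : IsClosed (Z : Set H))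
    (hP : IsClosed (P : Set H)) (hCcl : IsClosed (C : Set H)) (hZP : Disjoint Z P)
    (hC : IsCompl (Z ⊔ P) C) : ∀ᶠ p : (H →L[ℝ] H) × (H →L[ℝ] H) in 𝓝 (1, 1),
      Disjoint (Z.map (p.1 : H →ₗ[ℝ] H)) (P.map (p.2 : H →ₗ[ℝ] H)) ∧
        IsCompl (Z.map (p.1 : H →ₗ[ℝ] H) ⊔ P.map (p.2 : H →ₗ[ℝ] H)) C := by
  have := hZ.completeSpace_coe
  have := hP.completeSpace_coe
  have := hCcl.completeSpace_coe
  -- The decomposition says that the addition map `Z × P × C → H` is an isomorphism, and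
  -- isomorphisms form an open set.
  let Φ : (H →L[ℝ] H) × (H →L[ℝ] H) → (Z × P × C →L[ℝ] H) := fun p =>
    (p.1 ∘L Z.subtypeL) ∘L fst ℝ Z (P × C) + (p.2 ∘L P.subtypeL) ∘L fst ℝ P C ∘L snd ℝ Z (P × C) +
      C.subtypeL ∘L snd ℝ P C ∘L snd ℝ Z (P × C)
  have happ : ∀ p z, Φ p z = p.1 z.1 + p.2 z.2.1 + z.2.2 := fun p z => rfl
  have hcont : Continuous Φ := by
    simp only [Φ]
    fun_prop
  have hker : LinearMap.ker (Φ (1, 1) : (Z × P × C) →ₗ[ℝ] H) = ⊥ := by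
    rw [LinearMap.ker_eq_bot']
    rintro ⟨z, p, c⟩ h0
    have h0 : (z : H) + p + c = 0 := h0
    have hc : (c : H) = 0 := by
      have : (c : H) ∈ (Z ⊔ P) ⊓ C := by
        refine ⟨?_, c.2⟩
        rw [eq_neg_of_add_eq_zero_right h0]
        exact neg_mem (Submodule.add_mem_sup z.2 p.2)
      rwa [hC.inf_eq_bot, Submodule.mem_bot] at this
    rw [hc, add_zero] at h0
    have hp : (p : H) = 0 := by
      have : (p : H) ∈ Z ⊓ P := by
        refine ⟨?_, p.2⟩
        rw [eq_neg_of_add_eq_zero_right h0]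
        exact neg_mem z.2
      rwa [hZP.eq_bot, Submodule.mem_bot] at this
    rw [hp, add_zero] at h0
    ext <;> simp [*]
  have hran : LinearMap.range (Φ (1, 1) : (Z × P × C) →ₗ[ℝ] H) = ⊤ := by
    rw [eq_top_iff]
    intro y _
    have hy : y ∈ (Z ⊔ P) ⊔ C := by rw [hC.sup_eq_top]; trivial
    obtain ⟨w, hw, c, hc, rfl⟩ := Submodule.mem_sup.1 hy
    obtain ⟨z, hz, p, hp, rfl⟩ := Submodule.mem_sup.1 hw
    exact ⟨(⟨z, hz⟩, ⟨p, hp⟩, ⟨c, hc⟩), rfl⟩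
  have hnhds := ContinuousLinearEquiv.nhds (ContinuousLinearEquiv.ofBijective (Φ (1, 1)) hker hran)
  rw [ContinuousLinearEquiv.coe_ofBijective] at hnhds
  filter_upwards [hcont.continuousAt.preimage_mem_nhds hnhds] with p hp
  obtain ⟨e, he⟩ := hp
  have happ' : ∀ z : Z × P × C, e z = p.1 z.1 + p.2 z.2.1 + z.2.2 := fun z => by
    rw [← happ, ← he]; rfl
  refine ⟨?_, ?_, ?_⟩
  · rw [Submodule.disjoint_def]
    rintro _ ⟨z, hz, rfl⟩ ⟨q, hq, hzq⟩
    have : e (⟨z, hz⟩, -⟨q, hq⟩, 0) = 0 := by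
      rw [happ']
      change p.1 z + p.2 (-q) + 0 = 0
      rw [map_neg, add_zero]
      exact add_neg_eq_zero.2 hzq.symm
    rw [e.map_eq_zero_iff, Prod.mk_eq_zero] at this
    have hz0 : z = 0 := congrArg Subtype.val this.1
    rw [hz0, map_zero]
  · rw [Submodule.disjoint_def]
    rintro _ hx hxC
    obtain ⟨_, ⟨z, hz, rfl⟩, _, ⟨q, hq, rfl⟩, rfl⟩ := Submodule.mem_sup.1 hx
    have : e (⟨z, hz⟩, ⟨q, hq⟩, -⟨_, hxC⟩) = 0 := by
      rw [happ']
      exact add_neg_cancel _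
    rw [e.map_eq_zero_iff, Prod.mk_eq_zero, Prod.mk_eq_zero, neg_eq_zero] at this
    exact congrArg Subtype.val this.2.2
  · rw [codisjoint_iff, eq_top_iff]
    intro y _
    obtain ⟨⟨z, q, c⟩, rfl⟩ := e.surjective y
    rw [happ']
    exact Submodule.add_mem_sup (Submodule.add_mem_sup ⟨z, z.2, rfl⟩ ⟨q, q.2, rfl⟩) c.2

/-- The two intersections can each jump in dimension; only the difference is stable. Split `eigNeg
σ₀ = Z ⊕ F`, so that `H = Z ⊕ eigPos τ₀ ⊕ C`. The intertwiners `(1 + σ σ₀)/2` and `(1 + τ τ₀)/2` are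
close to `1` and move these spaces to those of `σ` and `τ`, with the same complement `C`. Then
`finrank_inf_add_finrank_compl` compares the indices. -/
lemma eventually_symIndex_eq {σ₀ τ₀ : H →L[ℝ] H} (hσ₀ : IsSymmetry σ₀) (hτ₀ : IsSymmetry τ₀)
    (h₀ : IsCompactOperator (σ₀ - τ₀)) : ∀ᶠ p : (H →L[ℝ] H) × (H →L[ℝ] H) in 𝓝 (σ₀, τ₀),
      IsSymmetry p.1 → IsSymmetry p.2 → IsCompactOperator (p.1 - p.2) →
        symIndex p.1 p.2 = symIndex σ₀ τ₀ := by
  have hF := IsSymmetry.finiteDimensional_inf h₀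
  have hCf : FiniteDimensional ℝ (eigNeg τ₀ ⊓ eigPos σ₀ : Submodule ℝ H) :=
    IsSymmetry.finiteDimensional_inf (by simpa using h₀.neg)
  have hcompl := hσ₀.isCompl_sup hτ₀ h₀
  set F := eigNeg σ₀ ⊓ eigPos τ₀ with hFdef
  set C := eigNeg τ₀ ⊓ eigPos σ₀
  set Z := Fᗮ ⊓ eigNeg σ₀ with hZ
  have : CompleteSpace F := FiniteDimensional.complete ℝ F
  have hFZ : F ⊔ Z = eigNeg σ₀ :=
    Submodule.sup_orthogonal_inf_of_hasOrthogonalProjection (by exact inf_le_left)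
  have hFZd : Disjoint Z F := (Submodule.orthogonal_disjoint F).symm.mono_left inf_le_left
  have hZP : Disjoint Z (eigPos τ₀) := by
    rw [Submodule.disjoint_def]
    intro x hx hxP
    exact (Submodule.disjoint_def.1 hFZd) x hx ⟨hx.2, hxP⟩
  have hZP' : Z ⊔ eigPos τ₀ = eigNeg σ₀ ⊔ eigPos τ₀ := by
    apply le_antisymm (sup_le_sup_right inf_le_right _)
    rw [← hFZ]
    exact sup_le (sup_le (inf_le_right.trans le_sup_right) le_sup_left) le_sup_right
  have hcl : IsClosed (Z : Set H) :=
    (Submodule.isClosed_orthogonal F).inter (IsSymmetry.isClosed_eigNeg σ₀)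
  have hclC : IsClosed (C : Set H) :=
    (IsSymmetry.isClosed_eigNeg τ₀).inter (IsSymmetry.isClosed_eigPos σ₀)
  have hev := eventually_isCompl_map hcl (IsSymmetry.isClosed_eigPos τ₀) hclC hZP
    (hZP' ▸ hcompl)
  have hunit : ∀ᶠ p : (H →L[ℝ] H) × (H →L[ℝ] H) in 𝓝 (1, 1), IsUnit p.1 ∧ IsUnit p.2 := by
    have h1 : ∀ᶠ g : H →L[ℝ] H in 𝓝 1, IsUnit g := Units.isOpen.mem_nhds isUnit_one
    exact (h1.prod_inl_nhds 1).and (h1.prod_inr_nhds 1)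
  let Ψ : (H →L[ℝ] H) × (H →L[ℝ] H) → (H →L[ℝ] H) × (H →L[ℝ] H) := fun p =>
    ((1 / 2 : ℝ) • (1 + p.1 * σ₀), (1 / 2 : ℝ) • (1 + p.2 * τ₀))
  have hΨ : Tendsto Ψ (𝓝 (σ₀, τ₀)) (𝓝 (1, 1)) := by
    have hc : Continuous Ψ := by fun_prop
    have h1 : Ψ (σ₀, τ₀) = (1, 1) := by
      simp only [Ψ, hσ₀.mul_self, hτ₀.mul_self]
      have : (1 / 2 : ℝ) • (1 + 1 : H →L[ℝ] H) = 1 := by module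
      rw [this]
    rw [← h1]
    exact hc.tendsto _
  filter_upwards [hΨ.eventually (hev.and hunit)] with p hp hσ hτ hc
  obtain ⟨⟨hd, hi⟩, hu1, hu2⟩ := hp
  have m1 := (hσ.map_eig hσ₀ hu1).1
  have m2 := (hτ.map_eig hτ₀ hu2).2
  have hinj := (ContinuousLinearMap.isUnit_iff_bijective.1 hu1).1
  have hkb : LinearMap.ker ((Ψ p).1 : H →ₗ[ℝ] H) = ⊥ := LinearMap.ker_eq_bot.2 hinj
  have hV : Z.map ((Ψ p).1 : H →ₗ[ℝ] H) ⊔ F.map ((Ψ p).1 : H →ₗ[ℝ] H) = eigNeg p.1 := by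
    rw [← Submodule.map_sup, sup_comm, hFZ]; exact m1
  rw [show (eigPos τ₀).map ((Ψ p).2 : H →ₗ[ℝ] H) = eigPos p.2 from m2] at hd hi
  have hZF' : Disjoint (Z.map ((Ψ p).1 : H →ₗ[ℝ] H)) (F.map ((Ψ p).1 : H →ₗ[ℝ] H)) :=
    (Submodule.disjoint_map hinj hFZd)
  have key := finrank_inf_add_finrank_compl hV hZF' hd hi (hσ.isCompl_sup hτ hc)
  rw [finrank_map_eq_of_disjoint_ker _ (by rw [hkb]; exact disjoint_bot_right)] at key
  have e0 : symIndex σ₀ τ₀ = (Module.finrank ℝ F : ℤ) - Module.finrank ℝ C := rfl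
  rw [e0, symIndex]
  omega

end SymmetryPairs

/-! ### Homotopy invariance, monotonicity and cogredience invariance of the relative Morse index. -/

section RelativeMorseIndex

open Filter ContinuousLinearMap

variable {H : Type*} [NormedAddCommGroup H] [InnerProductSpace ℝ H] [CompleteSpace H]

lemma IsRegularOp.negativeSpace_eq {c : ℝ} {T : H →L[ℝ] H} (h : IsRegularOp c T) :
    negativeSpace T = eigNeg (signOp c T) :=
  Submodule.ext fun _ => h.mem_negativeSpace_iff_signOp

lemma IsRegularOp.positiveSpace_eq {c : ℝ} {T : H →L[ℝ] H} (h : IsRegularOp c T) :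
    positiveSpace T = eigPos (signOp c T) :=
  Submodule.ext fun _ => h.mem_positiveSpace_iff_signOp

lemma relMorseIndex_eq_symIndex {c : ℝ} {S T : H →L[ℝ] H} (hS : IsRegularOp c S)
    (hT : IsRegularOp c T) : relMorseIndex S T = symIndex (signOp c S) (signOp c T) := by
  rw [relMorseIndex, symIndex, hS.negativeSpace_eq, hS.positiveSpace_eq, hT.negativeSpace_eq,
    hT.positiveSpace_eq]

lemma eventually_isRegularOp {c : ℝ} {T : H →L[ℝ] H} (hT : IsUnit T) (hc : ‖T‖ < c) :
    ∀ᶠ S in 𝓝 T, IsSelfAdjoint S → IsRegularOp c S := by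
  have h1 : ∀ᶠ S : H →L[ℝ] H in 𝓝 T, IsUnit S := Units.isOpen.mem_nhds hT
  filter_upwards [h1, continuous_norm.continuousAt.eventually_lt continuousAt_const hc]
    with S hu hn hsa
  exact ⟨(norm_nonneg _).trans_lt hn, hn.le, hsa, hu⟩

lemma eventually_relMorseIndex_eq {S₀ T₀ : H →L[ℝ] H} (hS₀ : IsSelfAdjoint S₀)
    (hS₀u : IsUnit S₀) (hT₀ : IsSelfAdjoint T₀) (hT₀u : IsUnit T₀)
    (h₀ : IsCompactOperator (S₀ - T₀)) : ∀ᶠ p : (H →L[ℝ] H) × (H →L[ℝ] H) in 𝓝 (S₀, T₀),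
      IsSelfAdjoint p.1 → IsSelfAdjoint p.2 → IsCompactOperator (p.1 - p.2) →
        relMorseIndex p.1 p.2 = relMorseIndex S₀ T₀ := by
  obtain ⟨c, hc⟩ := exists_gt (max ‖S₀‖ ‖T₀‖)
  rw [max_lt_iff] at hc
  have eS := eventually_isRegularOp hS₀u hc.1
  have eT := eventually_isRegularOp hT₀u hc.2
  have rS := eS.self_of_nhds hS₀
  have rT := eT.self_of_nhds hT₀
  have hsym := eventually_symIndex_eq rS.isSymmetry_signOp rT.isSymmetry_signOp
    (rS.isCompactOperator_signOp_sub rT h₀)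
  have hcont : Tendsto (fun p : (H →L[ℝ] H) × (H →L[ℝ] H) => (signOp c p.1, signOp c p.2))
      (𝓝 (S₀, T₀)) (𝓝 (signOp c S₀, signOp c T₀)) := by
    rw [nhds_prod_eq, nhds_prod_eq]
    exact Tendsto.prodMap rS.continuousAt_signOp rT.continuousAt_signOp
  filter_upwards [eS.prod_inl_nhds T₀, eT.prod_inr_nhds S₀, hcont.eventually hsym]
    with p h1 h2 h3 hp1 hp2 hp
  have r1 := h1 hp1
  have r2 := h2 hp2
  rw [relMorseIndex_eq_symIndex r1 r2, relMorseIndex_eq_symIndex rS rT]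
  exact h3 r1.isSymmetry_signOp r2.isSymmetry_signOp (r1.isCompactOperator_signOp_sub r2 hp)

/-- Homotopy invariance of the relative Morse index. -/
lemma relMorseIndex_eq_of_isPreconnected {X : Type*} [TopologicalSpace X] {s : Set X}
    (hs : IsPreconnected s) {S T : X → H →L[ℝ] H} (hS : ContinuousOn S s) (hT : ContinuousOn T s)
    (hSa : ∀ x ∈ s, IsSelfAdjoint (S x)) (hTa : ∀ x ∈ s, IsSelfAdjoint (T x))
    (hSu : ∀ x ∈ s, IsUnit (S x)) (hTu : ∀ x ∈ s, IsUnit (T x))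
    (h : ∀ x ∈ s, IsCompactOperator (S x - T x)) {x y : X} (hx : x ∈ s) (hy : y ∈ s) :
    relMorseIndex (S x) (T x) = relMorseIndex (S y) (T y) := by
  refine hs.constant (f := fun x => relMorseIndex (S x) (T x)) (fun z hz => ?_) hx hy
  refine continuousWithinAt_const.congr_of_eventuallyEq ?_ rfl
  have hev := eventually_relMorseIndex_eq (hSa z hz) (hSu z hz) (hTa z hz) (hTu z hz) (h z hz)
  have hc : Tendsto (fun w => (S w, T w)) (𝓝[s] z) (𝓝 (S z, T z)) :=
    Tendsto.prodMk_nhds (hS z hz) (hT z hz)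
  filter_upwards [hc.eventually hev, self_mem_nhdsWithin] with w h1 h2
  exact h1 (hSa w h2) (hTa w h2) (h w h2)

lemma exists_isRegularOp {T : H →L[ℝ] H} (hT : IsSelfAdjoint T) (hu : IsUnit T) :
    ∃ c, IsRegularOp c T :=
  ⟨‖T‖ + 1, by positivity, by linarith, hT, hu⟩

/-- Monotonicity of the relative Morse index. -/
lemma relMorseIndex_nonneg {S T : H →L[ℝ] H} (hS : IsSelfAdjoint S) (hSu : IsUnit S)
    (hT : IsSelfAdjoint T) (hTu : IsUnit T) (h : S ≤ T) : 0 ≤ relMorseIndex S T := by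
  obtain ⟨c, rS⟩ := exists_isRegularOp hS hSu
  obtain ⟨d, rT⟩ := exists_isRegularOp hT hTu
  have hbot : negativeSpace T ⊓ positiveSpace S = ⊥ := by
    rw [eq_bot_iff]
    rintro x ⟨h1, h2⟩
    by_contra h0
    have h3 := rT.inner_neg h1 h0
    have h4 := rS.inner_pos h2 h0
    have h5 := (ContinuousLinearMap.le_def S T).1 h |>.inner_nonneg_left x
    rw [sub_apply, inner_sub_left] at h5
    linarith
  rw [relMorseIndex, hbot, finrank_bot]
  simp

/-- Invariance of the relative Morse index under conformal cogredience. -/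
lemma relMorseIndex_conj_conformal {S T W : H →L[ℝ] H} {c : ℝ} (hc : c ≠ 0)
    (h1 : star W * W = (c * c) • (1 : H →L[ℝ] H)) (hW : IsUnit W) :
    relMorseIndex (star W * S * W) (star W * T * W) = relMorseIndex S T := by
  have hbij := ContinuousLinearMap.isUnit_iff_bijective.1 hW
  let e : H ≃ₗ[ℝ] H := LinearEquiv.ofBijective (W : H →ₗ[ℝ] H) hbij
  have he : ∀ x, e x = W x := fun x => rfl
  have hadj : ∀ x y, inner ℝ (star W x) y = inner ℝ x (W y) := fun x y => by
    rw [star_eq_adjoint, adjoint_inner_left]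
  have hstar : ∀ y, W (star W y) = (c * c) • y := by
    intro y
    obtain ⟨x, rfl⟩ := hbij.2 y
    have : star W (W x) = (c * c) • x := congrArg (fun A : H →L[ℝ] H => A x) h1
    rw [this, map_smul]
  have hcc : c * c ≠ 0 := mul_ne_zero hc hc
  -- Since `W W* = c²`, `W` intertwines `W* S W` with `c² S`, so it matches their invariant
  -- subspaces. For a general invertible `W` this fails.
  have hinv : ∀ (S : H →L[ℝ] H) (V : Submodule ℝ H),
      (∀ x ∈ V.map (e : H →ₗ[ℝ] H), S x ∈ V.map (e : H →ₗ[ℝ] H)) ↔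
        ∀ x ∈ V, (star W * S * W) x ∈ V := by
    intro S V
    have key : ∀ x, e ((star W * S * W) x) = (c * c) • S (W x) := fun x => hstar _
    constructor
    · intro h x hx
      have h2 := (V.map (e : H →ₗ[ℝ] H)).smul_mem (c * c) (h (e x) ⟨x, hx, rfl⟩)
      rw [he, ← key] at h2
      obtain ⟨z, hz, hze⟩ := h2
      rwa [← e.injective hze]
    · rintro h _ ⟨x, hx, rfl⟩
      refine ⟨(c * c)⁻¹ • (star W * S * W) x, V.smul_mem _ (h x hx), ?_⟩
      change e _ = S (W x)
      rw [map_smul, key, smul_smul, inv_mul_cancel₀ hcc, one_smul]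
  have hquad : ∀ (S : H →L[ℝ] H) x, inner ℝ ((star W * S * W) x) x = inner ℝ (S (W x)) (W x) :=
    fun S x => hadj _ _
  have hneg : ∀ S : H →L[ℝ] H,
      (negativeSpace (star W * S * W)).map (e : H →ₗ[ℝ] H) = negativeSpace S := by
    intro S
    have hset : ∀ V : Submodule ℝ H,
        ((∀ x ∈ V.map (e : H →ₗ[ℝ] H), S x ∈ V.map (e : H →ₗ[ℝ] H)) ∧
          ∀ x ∈ V.map (e : H →ₗ[ℝ] H), x ≠ 0 → inner ℝ (S x) x < 0) ↔
        ((∀ x ∈ V, (star W * S * W) x ∈ V) ∧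
          ∀ x ∈ V, x ≠ 0 → inner ℝ ((star W * S * W) x) x < 0) := by
      intro V
      refine and_congr (hinv S V) ⟨fun h x hx h0 => ?_, ?_⟩
      · rw [hquad]
        exact h _ ⟨x, hx, rfl⟩ (fun h' => h0 (e.map_eq_zero_iff.1 h'))
      · rintro h _ ⟨x, hx, rfl⟩ h0
        have := h x hx (fun h' => h0 (by rw [h', map_zero]))
        rwa [hquad] at this
    apply le_antisymm
    · rw [Submodule.map_le_iff_le_comap]
      refine sSup_le fun V hV => ?_
      rw [← Submodule.map_le_iff_le_comap]
      exact le_sSup ((hset V).2 hV)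
    · refine sSup_le fun V hV => ?_
      have hVm : (V.comap (e : H →ₗ[ℝ] H)).map (e : H →ₗ[ℝ] H) = V :=
        Submodule.map_comap_eq_of_surjective e.surjective V
      rw [← hVm]
      refine Submodule.map_mono (le_sSup ((hset _).1 ?_))
      rw [hVm]; exact hV
  have hpos : ∀ S : H →L[ℝ] H,
      (positiveSpace (star W * S * W)).map (e : H →ₗ[ℝ] H) = positiveSpace S := by
    intro S
    rw [← negativeSpace_neg, ← negativeSpace_neg, ← hneg (-S)]
    simp
  have hdim : ∀ A B : H →L[ℝ] H,
      Module.finrank ℝ (negativeSpace (star W * A * W) ⊓ positiveSpace (star W * B * W) :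
        Submodule ℝ H) = Module.finrank ℝ (negativeSpace A ⊓ positiveSpace B : Submodule ℝ H) := by
    intro A B
    rw [← hneg A, ← hpos B, ← Submodule.map_inf _ e.injective]
    exact (LinearEquiv.finrank_map_eq e _).symm
  simp only [relMorseIndex, hdim]

lemma isUnit_conj {U S : H →L[ℝ] H} (hU : IsUnit U) (hS : IsUnit S) :
    IsUnit (star U * S * U) := (hU.star.mul hS).mul hU

lemma isCompactOperator_conj_sub {U S T : H →L[ℝ] H} (h : IsCompactOperator (S - T)) :
    IsCompactOperator (star U * S * U - star U * T * U) := by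
  have e : star U * S * U - star U * T * U = star U * ((S - T) * U) := by noncomm_ring
  rw [e]
  exact (h.comp_clm U).clm_comp (star U)

/-- Invariance of the relative Morse index under cogredience. -/
lemma relMorseIndex_conj {S T U : H →L[ℝ] H} (hS : IsSelfAdjoint S) (hSu : IsUnit S)
    (hT : IsSelfAdjoint T) (hTu : IsUnit T) (h : IsCompactOperator (S - T)) (hU : IsUnit U) :
    relMorseIndex (star U * S * U) (star U * T * U) = relMorseIndex S T := by
  have hc : 0 < ‖U‖ + 1 := by positivity
  set c := ‖U‖ + 1
  have hx := norm_one_sub_star_mul_lt hc (by simp [c]) hU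
  set x : H →L[ℝ] H := 1 - (c⁻¹ * c⁻¹) • (star U * U) with hxdef
  have hstarx : star x = x := by simp [hxdef]
  set y := sqrtDefect x with hy
  have hys : star y = y := star_sqrtDefect hx hx hstarx
  have hR := isUnit_one_sub_sqrtDefect hx
  have hRR : (1 - y) * (1 - y) = (c⁻¹ * c⁻¹) • (star U * U) := by
    rw [one_sub_sqrtDefect_mul_self hx, hxdef, sub_sub_cancel]
  have hRs : star (1 - y) = 1 - y := by simp [hys]
  have hUU : star U * U = (c * c) • ((1 - y) * (1 - y)) := by
    rw [hRR, smul_smul, show c * c * (c⁻¹ * c⁻¹) = 1 by field_simp, one_smul]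
  -- Scaled polar decomposition: `1 - y` is `c⁻¹ |U|` and `O` is `c` times an orthogonal operator.
  -- The path `O (1 - s y)` of invertibles joins `O` to `U`.
  set O := U * Ring.inverse (1 - y) with hO
  have hOu : IsUnit O := hU.mul hR.ringInverse
  have hOO : star O * O = (c * c) • (1 : H →L[ℝ] H) := by
    rw [hO, star_mul, ← Ring.inverse_star, hRs]
    calc Ring.inverse (1 - y) * star U * (U * Ring.inverse (1 - y))
        = Ring.inverse (1 - y) * (star U * U) * Ring.inverse (1 - y) := by
          simp only [mul_assoc]
      _ = (c * c) • ((Ring.inverse (1 - y) * (1 - y)) * ((1 - y) * Ring.inverse (1 - y))) := by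
          rw [hUU]; simp only [mul_smul_comm, smul_mul_assoc, mul_assoc]
      _ = _ := by rw [Ring.inverse_mul_cancel _ hR, Ring.mul_inverse_cancel _ hR, mul_one]
  have hOU : O * (1 - y) = U := by
    rw [hO, mul_assoc, Ring.inverse_mul_cancel _ hR, mul_one]
  have hWu : ∀ s ∈ Icc (0 : ℝ) 1, IsUnit (O * (1 - s • y)) := fun s hs =>
    hOu.mul (isUnit_one_sub_smul_sqrtDefect hx hs)
  have hcont : ∀ A : H →L[ℝ] H,
      Continuous fun s : ℝ => star (O * (1 - s • y)) * A * (O * (1 - s • y)) := fun A => by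
    fun_prop
  have key := relMorseIndex_eq_of_isPreconnected (isPreconnected_Icc (a := (0 : ℝ)) (b := 1))
    (hcont S).continuousOn (hcont T).continuousOn
    (fun s _ => hS.conjugate' _) (fun s _ => hT.conjugate' _)
    (fun s hs => isUnit_conj (hWu s hs) hSu) (fun s hs => isUnit_conj (hWu s hs) hTu)
    (fun s _ => isCompactOperator_conj_sub h) (x := 1) (y := 0) (by simp) (by simp)
  simp only [one_smul, zero_smul, sub_zero, mul_one, hOU] at key
  rw [key]
  exact relMorseIndex_conj_conformal hc.ne' hOO hOu

end RelativeMorseIndex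

/-! ### Additivity of the relative Morse index by finite-dimensional approximation. -/

section ChainRule

open Filter ContinuousLinearMap

variable {H : Type*} [NormedAddCommGroup H] [InnerProductSpace ℝ H] [CompleteSpace H]

lemma isSelfAdjoint_starProjection' (G : Submodule ℝ H) [G.HasOrthogonalProjection] :
    star G.starProjection = G.starProjection :=
  (isSelfAdjoint_starProjection G).star_eq

/-- Compressions of a compact self-adjoint operator to large finite-dimensional subspaces
approximate it in norm. -/
lemma exists_norm_sub_compression_lt {K : H →L[ℝ] H} (hK : IsCompactOperator K)
    (hsa : IsSelfAdjoint K) {ε : ℝ} (hε : 0 < ε) :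
    ∃ G₀ : Submodule ℝ H, FiniteDimensional ℝ G₀ ∧
      ∀ (G : Submodule ℝ H) [FiniteDimensional ℝ G], G₀ ≤ G →
        ‖K - G.starProjection * K * G.starProjection‖ < ε := by
  obtain ⟨C, hC, hKC⟩ := hK.image_closedBall_subset_compact (f := (K : H →ₗ[ℝ] H)) 1
  obtain ⟨t, htf, ht⟩ := Metric.totallyBounded_iff.1 hC.totallyBounded (ε / 4) (by positivity)
  -- The span of a finite `ε/4`-net of the image of the unit ball: projecting onto it moves each `K
  -- x` by at most `ε/4`. Adjoints give the same bound on the other side.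
  refine ⟨Submodule.span ℝ t, FiniteDimensional.span_of_finite ℝ htf, fun G _ hG => ?_⟩
  have hPn : ∀ x, ‖G.starProjection x‖ ≤ ‖x‖ := fun x => by
    have := G.starProjection.le_of_opNorm_le G.starProjection_norm_le x
    simpa using this
  have h1 : ‖K - G.starProjection * K‖ ≤ ε / 4 := by
    refine opNorm_le_of_unit_norm (by positivity) fun x hx => ?_
    have hx1 : K x ∈ C := hKC ⟨x, by simp [hx], rfl⟩
    obtain ⟨y, hy, hxy⟩ := Set.mem_iUnion₂.1 (ht hx1)
    have hyG : y ∈ G := hG (Submodule.subset_span hy)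
    have hmin := G.starProjection_minimal (K x)
    change ‖K x - G.starProjection (K x)‖ ≤ ε / 4
    rw [hmin]
    refine (ciInf_le ⟨0, ?_⟩ (⟨y, hyG⟩ : G)).trans ?_
    · rintro _ ⟨z, rfl⟩; positivity
    · rw [Metric.mem_ball, dist_eq_norm] at hxy
      exact hxy.le
  have h2 : ‖K - K * G.starProjection‖ ≤ ε / 4 := by
    rw [← norm_star]
    simpa [hsa.star_eq, isSelfAdjoint_starProjection'] using h1
  have e : K - G.starProjection * K * G.starProjection =
      (K - G.starProjection * K) + G.starProjection * (K - K * G.starProjection) := by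
    noncomm_ring
  have h3 : ‖G.starProjection * (K - K * G.starProjection)‖ ≤ ‖K - K * G.starProjection‖ :=
    (norm_mul_le _ _).trans (mul_le_of_le_one_left (norm_nonneg _) G.starProjection_norm_le)
  rw [e]
  have := norm_add_le (K - G.starProjection * K) (G.starProjection * (K - K * G.starProjection))
  linarith

/-- `S` agrees with the symmetry `J` on the orthogonal complement of the `J`-invariant
subspace `G`. -/
structure IsBlock (J : H →L[ℝ] H) (G : Submodule ℝ H) (S : H →L[ℝ] H) : Prop where
  isSelfAdjoint : IsSelfAdjoint S
  isUnit : IsUnit S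
  eq_on : ∀ x ∈ Gᗮ, S x = J x

section Block

variable {J S : H →L[ℝ] H} {G : Submodule ℝ H}

lemma map_orthogonal_mem {T : H →L[ℝ] H} (hT : IsSelfAdjoint T) (hG : ∀ x ∈ G, T x ∈ G) :
    ∀ x ∈ Gᗮ, T x ∈ Gᗮ := by
  intro x hx
  rw [Submodule.mem_orthogonal] at *
  intro u hu
  rw [← inner_apply_left_of_isSelfAdjoint hT]
  exact hx _ (hG u hu)

variable (hJ : IsSymmetry J) (hG : ∀ x ∈ G, J x ∈ G)
include hJ hG

lemma IsBlock.map_orthogonal (hS : IsBlock J G S) {x : H} (hx : x ∈ Gᗮ) : S x ∈ Gᗮ := by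
  rw [hS.eq_on x hx]
  exact map_orthogonal_mem hJ.isSelfAdjoint hG x hx

variable [FiniteDimensional ℝ G]

lemma IsBlock.commute (hS : IsBlock J G S) : Commute G.starProjection S := by
  have h1 : ∀ x ∈ G, S x ∈ G := by
    intro x hx
    rw [← Submodule.orthogonal_orthogonal G] at hx ⊢
    exact map_orthogonal_mem hS.isSelfAdjoint (fun y hy => hS.map_orthogonal hJ hG hy) x hx
  ext x
  change G.starProjection (S x) = S (G.starProjection x)
  have hr : x - G.starProjection x ∈ Gᗮ := Submodule.sub_starProjection_mem_orthogonal x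
  have h2 := G.starProjection_eq_self_iff.2 (h1 _ (G.starProjection_apply_mem x))
  have h3 := (Submodule.starProjection_apply_eq_zero_iff (K := G)).2 (hS.map_orthogonal hJ hG hr)
  rw [map_sub, map_sub, h2, sub_eq_zero] at h3
  exact h3

/-- On `Gᗮ` the square of `S` is `1`, so `|S|` is `1` there: `z = |S| y - y` satisfies `|S| z = -z`,
which positivity forbids unless `z = 0`. -/
lemma IsBlock.signOp_of_mem_orthogonal {c : ℝ} (hS : IsBlock J G S) (rS : IsRegularOp c S)
    {x : H} (hx : x ∈ Gᗮ) : signOp c S x = J x := by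
  have hSS : ∀ y ∈ Gᗮ, S (S y) = y := by
    intro y hy
    rw [hS.eq_on _ (hS.map_orthogonal hJ hG hy), hS.eq_on y hy, hJ.apply_apply]
  have habs : ∀ y ∈ Gᗮ, absOp c S y = y := by
    intro y hy
    have h1 : absOp c S (absOp c S y) = y := by
      have : absOp c S (absOp c S y) = S (S y) :=
        congrArg (fun A : H →L[ℝ] H => A y) rS.absOp_mul_self
      rw [this, hSS y hy]
    set z := absOp c S y - y with hz
    have h2 : absOp c S z = -z := by rw [hz, map_sub, h1]; abel
    by_contra h0
    have hz0 : z ≠ 0 := fun h => h0 (sub_eq_zero.1 h)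
    have h3 := rS.absOp_pos hz0
    rw [h2, inner_neg_left, real_inner_self_eq_norm_sq] at h3
    nlinarith [sq_nonneg ‖z‖]
  have h1 : signOp c S (absOp c S x) = S x :=
    congrArg (fun A : H →L[ℝ] H => A x) rS.signOp_mul_absOp
  rw [habs x hx] at h1
  rw [h1, hS.eq_on x hx]

lemma IsBlock.signOp_commute {c : ℝ} (hS : IsBlock J G S) (rS : IsRegularOp c S) (x : H) :
    G.starProjection (signOp c S x) = signOp c S (G.starProjection x) := by
  have hc := hS.commute hJ hG
  exact congrArg (fun A : H →L[ℝ] H => A x) (hc.mul_right (rS.commute_inverse hc)).eq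

/-- Outside `G` both signs equal `J`, so the component `r` in `Gᗮ` satisfies `J r = -r` and `J r =
r`. -/
lemma IsBlock.eigNeg_inf_eigPos_le {c d : ℝ} {T : H →L[ℝ] H} (hS : IsBlock J G S)
    (hT : IsBlock J G T) (rS : IsRegularOp c S) (rT : IsRegularOp d T) :
    eigNeg (signOp c S) ⊓ eigPos (signOp d T) ≤ G := by
  have cS := hS.signOp_commute hJ hG rS
  have cT := hT.signOp_commute hJ hG rT
  have oS := fun x hx => hS.signOp_of_mem_orthogonal hJ hG rS (x := x) hx
  have oT := fun x hx => hT.signOp_of_mem_orthogonal hJ hG rT (x := x) hx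
  set σ := signOp c S
  set τ := signOp d T
  rintro x ⟨h1, h2⟩
  set r := x - G.starProjection x with hr
  have hro : r ∈ Gᗮ := Submodule.sub_starProjection_mem_orthogonal x
  have h3 : σ r = -r := by
    rw [hr, map_sub, ← cS, mem_eigNeg.1 h1, map_neg]; abel
  have h4 : τ r = r := by rw [hr, map_sub, ← cT, mem_eigPos.1 h2]
  rw [oS r hro] at h3
  rw [oT r hro] at h4
  rw [h4] at h3
  have h5 : r = 0 := by
    have h6 : (2 : ℝ) • r = 0 := by rw [two_smul, ← eq_neg_iff_add_eq_zero]; exact h3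
    simpa using h6
  rw [hr, sub_eq_zero] at h5
  rw [h5]
  exact G.starProjection_apply_mem x

/-- With `A = E⁻(S) ∩ G` and `B = E⁺(T) ∩ G`, the first intersection in the index is `A ∩ B` and the
second is the orthogonal complement of `A + B` in `G`. The resulting formula separates `S` from `T`,
which makes additivity arithmetic. -/
lemma IsBlock.relMorseIndex_add {T : H →L[ℝ] H} (hS : IsBlock J G S) (hT : IsBlock J G T) :
    relMorseIndex S T + Module.finrank ℝ G =
      Module.finrank ℝ (negativeSpace S ⊓ G : Submodule ℝ H) +
        Module.finrank ℝ (positiveSpace T ⊓ G : Submodule ℝ H) := by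
  obtain ⟨c, rS⟩ := exists_isRegularOp hS.isSelfAdjoint hS.isUnit
  obtain ⟨d, rT⟩ := exists_isRegularOp hT.isSelfAdjoint hT.isUnit
  rw [relMorseIndex, rS.negativeSpace_eq, rS.positiveSpace_eq, rT.negativeSpace_eq,
    rT.positiveSpace_eq]
  have symS := rS.isSymmetry_signOp
  have symT := rT.isSymmetry_signOp
  have cS := hS.signOp_commute hJ hG rS
  have cT := hT.signOp_commute hJ hG rT
  set σ := signOp c S
  set τ := signOp d T
  have hle : eigNeg σ ⊓ eigPos τ ≤ G := hS.eigNeg_inf_eigPos_le hJ hG hT rS rT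
  have e1 : eigNeg σ ⊓ eigPos τ = (eigNeg σ ⊓ G) ⊓ (eigPos τ ⊓ G) := by
    apply le_antisymm
    · exact le_inf (le_inf inf_le_left hle) (le_inf inf_le_right hle)
    · exact inf_le_inf inf_le_left inf_le_left
  have hle' : eigNeg τ ⊓ eigPos σ ≤ G := hT.eigNeg_inf_eigPos_le hJ hG hS rT rS
  have e2 : eigNeg τ ⊓ eigPos σ = ((eigNeg σ ⊓ G) ⊔ (eigPos τ ⊓ G))ᗮ ⊓ G := by
    apply le_antisymm
    · intro x hx
      refine ⟨?_, hle' hx⟩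
      rw [SetLike.mem_coe, Submodule.mem_orthogonal]
      intro y hy
      obtain ⟨a, ha, b, hb, rfl⟩ := Submodule.mem_sup.1 hy
      rw [inner_add_left, symS.inner_eq_zero ha.1 hx.2, real_inner_comm,
        symT.inner_eq_zero hx.1 hb.1, add_zero]
    · rintro x ⟨hx, hxG⟩
      rw [SetLike.mem_coe, Submodule.mem_orthogonal] at hx
      have hPx := G.starProjection_eq_self_iff.2 hxG
      constructor
      · have hb : (1 / 2 : ℝ) • (x + τ x) ∈ eigPos τ ⊓ G := by
          refine ⟨symT.add_mem_eigPos x, G.smul_mem _ (G.add_mem hxG ?_)⟩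
          rw [← hPx, ← cT]; exact G.starProjection_apply_mem _
        have h1 := hx _ (Submodule.mem_sup_right hb)
        have h2 := symT.inner_eq_zero (symT.sub_mem_eigNeg x) hb.1
        have h3 : x = (1 / 2 : ℝ) • (x - τ x) + (1 / 2 : ℝ) • (x + τ x) := by module
        nth_rw 3 [h3] at h1
        rw [inner_add_right, real_inner_comm, h2, zero_add, inner_self_eq_zero] at h1
        refine mem_eigNeg.2 (eq_neg_of_add_eq_zero_right ?_)
        exact (smul_eq_zero.1 h1).resolve_left (by norm_num)
      · have hb : (1 / 2 : ℝ) • (x - σ x) ∈ eigNeg σ ⊓ G := by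
          refine ⟨symS.sub_mem_eigNeg x, G.smul_mem _ (G.sub_mem hxG ?_)⟩
          rw [← hPx, ← cS]; exact G.starProjection_apply_mem _
        have h1 := hx _ (Submodule.mem_sup_left hb)
        have h2 := symS.inner_eq_zero hb.1 (symS.add_mem_eigPos x)
        have h3 : x = (1 / 2 : ℝ) • (x - σ x) + (1 / 2 : ℝ) • (x + σ x) := by module
        nth_rw 3 [h3] at h1
        rw [inner_add_right, h2, add_zero, inner_self_eq_zero] at h1
        refine mem_eigPos.2 (sub_eq_zero.1 ?_).symm
        exact (smul_eq_zero.1 h1).resolve_left (by norm_num)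
  have fA : FiniteDimensional ℝ (eigNeg σ ⊓ G : Submodule ℝ H) :=
    Submodule.finiteDimensional_of_le inf_le_right
  have fB : FiniteDimensional ℝ (eigPos τ ⊓ G : Submodule ℝ H) :=
    Submodule.finiteDimensional_of_le inf_le_right
  have d1 := Submodule.finrank_sup_add_finrank_inf_eq (eigNeg σ ⊓ G) (eigPos τ ⊓ G)
  have d2 := Submodule.finrank_add_inf_finrank_orthogonal
    (sup_le inf_le_right inf_le_right : (eigNeg σ ⊓ G) ⊔ (eigPos τ ⊓ G) ≤ G)
  rw [e2, e1]
  omega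

lemma IsBlock.relMorseIndex_chain {T U : H →L[ℝ] H} (hS : IsBlock J G S) (hT : IsBlock J G T)
    (hU : IsBlock J G U) : relMorseIndex S T + relMorseIndex T U = relMorseIndex S U := by
  have h1 := hS.relMorseIndex_add hJ hG hT
  have h2 := hT.relMorseIndex_add hJ hG hU
  have h3 := hS.relMorseIndex_add hJ hG hU
  -- The case `S = T` gives `dim G = dim (E⁻(T) ∩ G) + dim (E⁺(T) ∩ G)`.
  have h4 := hT.relMorseIndex_add hJ hG hT
  have h5 : relMorseIndex T T = 0 := by simp [relMorseIndex]
  omega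

end Block

/-- The approximant is `J + P (S - J) P` with `P` the projection onto `G`; it is invertible because
it is close to `S`. -/
lemma exists_isBlock_near {J S : H →L[ℝ] H} (hJ : IsSymmetry J) (hS : IsSelfAdjoint S)
    (hSu : IsUnit S) (hK : IsCompactOperator (S - J)) {ε : ℝ} (hε : 0 < ε) :
    ∃ G₀ : Submodule ℝ H, FiniteDimensional ℝ G₀ ∧
      ∀ (G : Submodule ℝ H) [FiniteDimensional ℝ G], G₀ ≤ G →
        ∃ S', IsBlock J G S' ∧ dist S' S < ε ∧ IsCompactOperator (S' - J) := by
  obtain ⟨δ, hδ, hball⟩ := Metric.isOpen_iff.1 Units.isOpen S hSu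
  obtain ⟨G₀, hfin, h⟩ := exists_norm_sub_compression_lt hK (hS.sub hJ.isSelfAdjoint)
    (lt_min hε hδ)
  refine ⟨G₀, hfin, fun G _ hG => ?_⟩
  have hn := h G hG
  set F := G.starProjection * (S - J) * G.starProjection with hF
  have hd : dist (J + F) S < min ε δ := by
    rw [dist_comm, dist_eq_norm, sub_add_eq_sub_sub]
    exact hn
  have hFs : star F = F := by
    simp only [hF, star_mul, isSelfAdjoint_starProjection', star_sub, hS.star_eq,
      hJ.isSelfAdjoint.star_eq, mul_assoc]
  refine ⟨J + F, ⟨hJ.isSelfAdjoint.add hFs, hball (hd.trans_le (min_le_right _ _)), ?_⟩,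
    hd.trans_le (min_le_left _ _), ?_⟩
  · intro x hx
    have h0 := (Submodule.starProjection_apply_eq_zero_iff (K := G)).2 hx
    change J x + G.starProjection ((S - J) (G.starProjection x)) = J x
    rw [h0, map_zero, map_zero, add_zero]
  · rw [add_sub_cancel_left]
    exact (hK.comp_clm G.starProjection).clm_comp G.starProjection

lemma isCompactOperator_sub_of_sub {A B J : H →L[ℝ] H} (hA : IsCompactOperator (A - J))
    (hB : IsCompactOperator (B - J)) : IsCompactOperator (A - B) := by
  have := hA.sub hB
  rwa [← FunLike.coe_sub, sub_sub_sub_cancel_right] at this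

/-- The chain rule for the relative Morse index. -/
lemma relMorseIndex_add_relMorseIndex {J S T U : H →L[ℝ] H} (hJ : IsSymmetry J)
    (hS : IsSelfAdjoint S) (hSu : IsUnit S) (hSK : IsCompactOperator (S - J))
    (hT : IsSelfAdjoint T) (hTu : IsUnit T) (hTK : IsCompactOperator (T - J))
    (hU : IsSelfAdjoint U) (hUu : IsUnit U) (hUK : IsCompactOperator (U - J)) :
    relMorseIndex S T + relMorseIndex T U = relMorseIndex S U := by
  obtain ⟨ε₁, hε₁, h₁⟩ := Metric.eventually_nhds_iff.1
    (eventually_relMorseIndex_eq hS hSu hT hTu (isCompactOperator_sub_of_sub hSK hTK))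
  obtain ⟨ε₂, hε₂, h₂⟩ := Metric.eventually_nhds_iff.1
    (eventually_relMorseIndex_eq hT hTu hU hUu (isCompactOperator_sub_of_sub hTK hUK))
  obtain ⟨ε₃, hε₃, h₃⟩ := Metric.eventually_nhds_iff.1
    (eventually_relMorseIndex_eq hS hSu hU hUu (isCompactOperator_sub_of_sub hSK hUK))
  have hε : 0 < min ε₁ (min ε₂ ε₃) := lt_min hε₁ (lt_min hε₂ hε₃)
  obtain ⟨G₁, _, k₁⟩ := exists_isBlock_near hJ hS hSu hSK hε
  obtain ⟨G₂, _, k₂⟩ := exists_isBlock_near hJ hT hTu hTK hε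
  obtain ⟨G₃, _, k₃⟩ := exists_isBlock_near hJ hU hUu hUK hε
  set G' := G₁ ⊔ (G₂ ⊔ G₃)
  -- Adding the image under `J` makes the subspace `J`-invariant and keeps it finite-dimensional.
  set G := G' ⊔ G'.map (J : H →ₗ[ℝ] H)
  have hG : ∀ x ∈ G, J x ∈ G := by
    intro x hx
    obtain ⟨y, hy, _, ⟨z, hz, rfl⟩, rfl⟩ := Submodule.mem_sup.1 hx
    change J (y + J z) ∈ G
    rw [map_add, hJ.apply_apply, add_comm]
    exact Submodule.add_mem_sup hz ⟨y, hy, rfl⟩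
  have hG' : G' ≤ G := le_sup_left
  obtain ⟨S', bS, dS, cS⟩ := k₁ G (le_sup_left.trans hG')
  obtain ⟨T', bT, dT, cT⟩ := k₂ G ((le_sup_left.trans le_sup_right).trans hG')
  obtain ⟨U', bU, dU, cU⟩ := k₃ G ((le_sup_right.trans le_sup_right).trans hG')
  simp only [lt_min_iff] at dS dT dU
  have q₁ := h₁ (y := (S', T')) (max_lt dS.1 dT.1) bS.isSelfAdjoint bT.isSelfAdjoint
    (isCompactOperator_sub_of_sub cS cT)
  have q₂ := h₂ (y := (T', U')) (max_lt dT.2.1 dU.2.1) bT.isSelfAdjoint bU.isSelfAdjoint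
    (isCompactOperator_sub_of_sub cT cU)
  have q₃ := h₃ (y := (S', U')) (max_lt dS.2.2 dU.2.2) bS.isSelfAdjoint bU.isSelfAdjoint
    (isCompactOperator_sub_of_sub cS cU)
  rw [← q₁, ← q₂, ← q₃]
  exact bS.relMorseIndex_chain hJ hG bT bU

end ChainRule

/-! ### Existence of cogredient parametrices. -/

section Parametrix

open Filter ContinuousLinearMap

variable {H : Type*} [NormedAddCommGroup H] [InnerProductSpace ℝ H] [CompleteSpace H]

/-- An invertible self-adjoint operator is cogredient to a symmetry. -/
lemma exists_cogredient_symmetry {A : H →L[ℝ] H} (hA : IsSelfAdjoint A) (hu : IsUnit A) :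
    ∃ J N : H →L[ℝ] H, IsSymmetry J ∧ IsUnit N ∧ star N * A * N = J := by
  obtain ⟨c, h⟩ := exists_isRegularOp hA hu
  have hx := h.norm_sqDefect_lt
  have hy : ‖sqrtDefect (sqDefect c A)‖ < 1 := (norm_sqrtDefect_le hx).trans_lt hx
  set y := sqrtDefect (sqDefect c A) with hydef
  have habs : absOp c A = c • (1 - y) := rfl
  -- `M` is the square root of `|A| = c (1 - y)`; it commutes with `A`, so `M⁻¹ A M⁻¹` is the sign
  -- of `A`.
  set M : H →L[ℝ] H := Real.sqrt c • (1 - sqrtDefect y) with hM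
  have hMM : M * M = absOp c A := by
    rw [hM, smul_mul_smul_comm, one_sub_sqrtDefect_mul_self hy, Real.mul_self_sqrt h.pos.le, habs]
  have hMu : IsUnit M :=
    (isUnit_one_sub_sqrtDefect hy).smul (Units.mk0 _ (Real.sqrt_pos.2 h.pos).ne')
  have hstary : star y = y := by
    have hT := hA.star_eq
    exact star_sqrtDefect hx hx (by simp [sqDefect, hT])
  have hMs : star M = M := by
    have := star_sqrtDefect hy hy hstary
    simp [hM, this]
  have hAy : Commute A y := sqrtDefect_commute hx ((Commute.one_right A).sub_right
    (((Commute.refl A).mul_right (Commute.refl A)).smul_right _))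
  have hAM : Commute A M :=
    ((Commute.one_right A).sub_right (sqrtDefect_commute hy hAy)).smul_right _
  have hAN : Commute A (Ring.inverse M) := by
    obtain ⟨u, hu⟩ := hMu
    rw [← hu, Ring.inverse_unit]
    exact Commute.units_inv_right (hu ▸ hAM)
  refine ⟨signOp c A, Ring.inverse M, h.isSymmetry_signOp, hMu.ringInverse, ?_⟩
  rw [← Ring.inverse_star, hMs, ← hAN.eq, mul_assoc, signOp, ← hMM,
    Ring.mul_inverse_rev' (Commute.refl M)]

/-- The orthogonal projection onto the kernel of a self-adjoint Fredholm operator. -/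
lemma exists_compact_projection {T : H →L[ℝ] H} (hT : T ∈ selfAdjointFredholm H) :
    ∃ P : H →L[ℝ] H, IsSelfAdjoint P ∧ IsCompactOperator P ∧ T * P = 0 ∧ P * T = 0 ∧
      IsUnit (T + P) := by
  obtain ⟨hsa, hF⟩ := hT
  set V : Submodule ℝ H := T.ker with hV
  have hVmem : ∀ x, x ∈ V ↔ T x = 0 := fun x => LinearMap.mem_ker
  have : FiniteDimensional ℝ V := hF.finite_ker
  set R : Submodule ℝ H := T.range with hR
  have hRmem : ∀ x, T x ∈ R := fun x => ⟨x, rfl⟩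
  have hcl : CompleteSpace R := hF.isClosed_range.completeSpace_coe
  have hort : Rᗮ ≤ V := by
    intro x hx
    rw [hVmem, ← inner_self_eq_zero (𝕜 := ℝ), inner_apply_left_of_isSelfAdjoint hsa,
      real_inner_comm]
    exact (Submodule.mem_orthogonal _ _).1 hx _ (hRmem _)
  have hTV : ∀ x, T x ∈ Vᗮ := by
    intro x
    rw [Submodule.mem_orthogonal]
    intro v hv
    rw [← inner_apply_left_of_isSelfAdjoint hsa, (hVmem v).1 hv, inner_zero_left]
  have hTP : ∀ x, T (V.starProjection x) = 0 := fun x =>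
    (hVmem _).1 (V.starProjection_apply_mem x)
  have hPT : ∀ x, V.starProjection (T x) = 0 := fun x =>
    (Submodule.starProjection_apply_eq_zero_iff V).2 (hTV x)
  have hPV : ∀ x ∈ V, V.starProjection x = x := fun x hx =>
    Submodule.starProjection_eq_self_iff.2 hx
  refine ⟨V.starProjection, isSelfAdjoint_starProjection V, isCompactOperator_starProjection V,
    ContinuousLinearMap.ext hTP, ContinuousLinearMap.ext hPT, ?_⟩
  rw [ContinuousLinearMap.isUnit_iff_bijective]
  constructor
  · rw [injective_iff_map_eq_zero]
    intro x hx
    have hx : T x + V.starProjection x = 0 := hx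
    have h1 : V.starProjection x = 0 := by
      have := congrArg V.starProjection hx
      rwa [map_add, hPT, zero_add, hPV _ (V.starProjection_apply_mem x), map_zero] at this
    rw [h1, add_zero, ← hVmem] at hx
    rw [← hPV x hx, h1]
  · intro y
    have hy : y ∈ R ⊔ Rᗮ := by
      rw [Submodule.sup_orthogonal_of_hasOrthogonalProjection]; trivial
    obtain ⟨_, ⟨x, rfl⟩, k, hk, rfl⟩ := Submodule.mem_sup.1 hy
    have hkV := hort hk
    -- The kernel component of `x` is exchanged for `k`: `T` does not see the change and the
    -- projection returns `k`.
    refine ⟨x - V.starProjection x + k, ?_⟩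
    change T (x - V.starProjection x + k) + V.starProjection (x - V.starProjection x + k) = T x + k
    rw [map_add, map_sub, map_add, map_sub, hTP, hPV _ (V.starProjection_apply_mem x), hPV k hkV,
      (hVmem k).1 hkV]
    abel

lemma exists_cogredient_symmetry_of_fredholm {T : H →L[ℝ] H} (hT : T ∈ selfAdjointFredholm H) :
    ∃ J N : H →L[ℝ] H, IsSymmetry J ∧ IsUnit N ∧ IsCompactOperator (star N * T * N - J) := by
  obtain ⟨P, hPs, hPc, -, -, hu⟩ := exists_compact_projection hT
  obtain ⟨J, N, hJ, hN, h⟩ := exists_cogredient_symmetry (hT.1.add hPs) hu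
  refine ⟨J, N, hJ, hN, ?_⟩
  rw [← h]
  exact isCompactOperator_conj_sub (by simpa using hPc.neg)

/-- `0` is at most an isolated point of the spectrum of a self-adjoint Fredholm operator. -/
lemma eventually_isUnit_add_smul {T : H →L[ℝ] H} (hT : T ∈ selfAdjointFredholm H) :
    ∀ᶠ δ : ℝ in 𝓝[>] 0, IsUnit (T + δ • ContinuousLinearMap.id ℝ H) := by
  obtain ⟨P, -, -, hTP, hPT, hu⟩ := exists_compact_projection hT
  have hc : Continuous fun δ : ℝ => T + P + δ • (1 : H →L[ℝ] H) := by fun_prop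
  have hev : ∀ᶠ δ : ℝ in 𝓝 0, IsUnit (T + P + δ • (1 : H →L[ℝ] H)) :=
    hc.continuousAt.eventually_mem (Units.isOpen.mem_nhds (by simpa using hu))
  filter_upwards [hev.filter_mono nhdsWithin_le_nhds, self_mem_nhdsWithin] with δ h hδ
  have hδ : δ ≠ 0 := (show 0 < δ from hδ).ne'
  change IsUnit (T + δ • (1 : H →L[ℝ] H))
  -- `T + δ` is a factor, with commuting cofactor, of `T + P + δ`, which is invertible for small
  -- `δ`.
  have e1 : (T + δ • (1 : H →L[ℝ] H)) * (1 + δ⁻¹ • P) = T + P + δ • (1 : H →L[ℝ] H) := by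
    rw [mul_add, mul_one, mul_smul_comm, add_mul, hTP, zero_add, smul_mul_assoc, one_mul,
      smul_smul, inv_mul_cancel₀ hδ, one_smul]
    abel
  have e2 : (1 + δ⁻¹ • P) * (T + δ • (1 : H →L[ℝ] H)) = T + P + δ • (1 : H →L[ℝ] H) := by
    rw [add_mul, one_mul, smul_mul_assoc, mul_add, hPT, zero_add, mul_smul_comm, mul_one,
      smul_smul, inv_mul_cancel₀ hδ, one_smul]
    abel
  have hcomm : Commute (T + δ • (1 : H →L[ℝ] H)) (1 + δ⁻¹ • P) := e1.trans e2.symm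
  exact (hcomm.isUnit_mul_iff.1 (e1 ▸ h)).1

lemma IsSymmetry.norm_mul_le {J : H →L[ℝ] H} (hJ : IsSymmetry J) (E : H →L[ℝ] H) :
    ‖J * E‖ ≤ ‖E‖ :=
  opNorm_le_bound _ (norm_nonneg _) fun x => by
    change ‖J (E x)‖ ≤ _
    rw [hJ.norm_apply]
    exact E.le_opNorm x

/-- The operator `(1 + J E)^(-1/2)`, which transforms `J + E` into `J`. -/
noncomputable def symCorrection (J E : H →L[ℝ] H) : H →L[ℝ] H :=
  Ring.inverse (1 - sqrtDefect (-(J * E)))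

namespace IsSymmetry

variable {J E : H →L[ℝ] H} (hJ : IsSymmetry J) (hE : ‖E‖ < 1)
include hJ hE

lemma norm_neg_mul_lt : ‖-(J * E)‖ < 1 := by
  rw [norm_neg]
  exact (hJ.norm_mul_le E).trans_lt hE

lemma isUnit_symCorrection : IsUnit (symCorrection J E) :=
  (isUnit_one_sub_sqrtDefect (hJ.norm_neg_mul_lt hE)).ringInverse

lemma continuousAt_symCorrection : ContinuousAt (symCorrection J) E := by
  have hx := hJ.norm_neg_mul_lt hE
  have h1 : ContinuousAt (fun E : H →L[ℝ] H => sqrtDefect (-(J * E))) E :=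
    ContinuousAt.comp (f := fun E : H →L[ℝ] H => -(J * E)) (continuousAt_sqrtDefect hx)
      (by fun_prop)
  obtain ⟨u, hu⟩ := isUnit_one_sub_sqrtDefect hx
  refine ContinuousAt.comp (g := Ring.inverse) (f := fun E : H →L[ℝ] H => 1 - sqrtDefect (-(J * E)))
    ?_ (by fun_prop)
  rw [← hu]
  exact NormedRing.inverse_continuousAt u

/-- Let `s` be the root of `1 + J E`, so that `J + E = J s²`. Since `(J E)* = E J = J (J E) J`, also
`s* = J s J`. Hence the product is `J s⁻¹ J · J s² · s⁻¹ = J`. -/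
lemma star_symCorrection_mul (hEs : IsSelfAdjoint E) :
    star (symCorrection J E) * (J + E) * symCorrection J E = J := by
  have hx := hJ.norm_neg_mul_lt hE
  have hJJ := hJ.mul_self
  have hJs := hJ.isSelfAdjoint.star_eq
  have hxs : star (-(J * E)) = -(E * J) := by simp [hJs, hEs.star_eq]
  have hx' : ‖-(E * J)‖ < 1 := by rw [← hxs]; exact (norm_star _).trans_lt hx
  have hss := one_sub_sqrtDefect_mul_self hx
  have hu := isUnit_one_sub_sqrtDefect hx
  have h1 := star_sqrtDefect hx hx' hxs
  have h2 := conj_sqrtDefect hJJ hx hx' (by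
    rw [mul_neg, ← mul_assoc, hJJ, one_mul, neg_mul])
  have hm : symCorrection J E = Ring.inverse (1 - sqrtDefect (-(J * E))) := rfl
  set s := 1 - sqrtDefect (-(J * E)) with hs
  have hstar : star s = J * s * J := by
    rw [hs, star_sub, star_one, h1, ← h2, mul_sub, sub_mul, mul_one, hJJ]
  have hms : Ring.inverse s * s = 1 := Ring.inverse_mul_cancel _ hu
  have hsm : s * Ring.inverse s = 1 := Ring.mul_inverse_cancel _ hu
  have hinv : Ring.inverse (J * s * J) = J * Ring.inverse s * J := by
    have e1 : (J * s * J) * (J * Ring.inverse s * J) = 1 := by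
      calc (J * s * J) * (J * Ring.inverse s * J)
          = J * s * (J * J) * Ring.inverse s * J := by simp only [mul_assoc]
        _ = 1 := by rw [hJJ, mul_one, mul_assoc J, hsm, mul_one, hJJ]
    have e2 : (J * Ring.inverse s * J) * (J * s * J) = 1 := by
      calc (J * Ring.inverse s * J) * (J * s * J)
          = J * Ring.inverse s * (J * J) * s * J := by simp only [mul_assoc]
        _ = 1 := by rw [hJJ, mul_one, mul_assoc J, hms, mul_one, hJJ]
    exact Ring.inverse_unit (⟨_, _, e1, e2⟩ : (H →L[ℝ] H)ˣ)
  have hJE : J * (J + E) = s * s := by rw [hss, mul_add, hJJ, sub_neg_eq_add]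
  rw [hm, ← Ring.inverse_star, hstar, hinv]
  calc J * Ring.inverse s * J * (J + E) * Ring.inverse s
      = J * Ring.inverse s * (J * (J + E)) * Ring.inverse s := by simp only [mul_assoc]
    _ = J * (Ring.inverse s * s) * (s * Ring.inverse s) := by rw [hJE]; simp only [mul_assoc]
    _ = J := by rw [hms, hsm, mul_one, mul_one]

end IsSymmetry

/-- Correcting a parametrix after a small perturbation `D` of the operator `L`. -/
lemma isCompactOperator_symCorrection {J N L D : H →L[ℝ] H} (hJ : IsSymmetry J)
    (h : IsCompactOperator (star N * L * N - J)) (hD : IsSelfAdjoint D)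
    (hlt : ‖star N * D * N‖ < 1) :
    IsCompactOperator (star (N * symCorrection J (star N * D * N)) * (L + D) *
      (N * symCorrection J (star N * D * N)) - J) := by
  have hs := hJ.star_symCorrection_mul hlt (hD.conjugate' N)
  set m := symCorrection J (star N * D * N)
  have e : star (N * m) * (L + D) * (N * m) - J = star m * ((star N * L * N - J) * m) := by
    conv_lhs => rw [← hs]
    rw [star_mul]
    noncomm_ring
  rw [e]
  exact (h.comp_clm m).clm_comp (star m)

lemma isCogredientParametrix_iff {a b : ℝ} {L N : ℝ → H →L[ℝ] H} {J : H →L[ℝ] H} :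
    IsCogredientParametrix a b L J N ↔ ContinuousOn N (Icc a b) ∧ (∀ t ∈ Icc a b, IsUnit (N t)) ∧
      ∀ t ∈ Icc a b, IsCompactOperator (star (N t) * L t * N t - J) :=
  ⟨fun h => ⟨h.1, h.2, h.3⟩, fun h => ⟨h.1, h.2.1, h.2.2⟩⟩

lemma continuousOn_inverse {X : Type*} [TopologicalSpace X] {s : Set X} {N : X → H →L[ℝ] H}
    (hN : ContinuousOn N s) (hu : ∀ x ∈ s, IsUnit (N x)) :
    ContinuousOn (fun x => Ring.inverse (N x)) s := by
  intro x hx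
  obtain ⟨u, hu⟩ := hu x hx
  have := NormedRing.inverse_continuousAt u
  rw [hu] at this
  exact this.comp_continuousWithinAt (hN x hx)

/-- Two parametrices on adjacent intervals can be joined. -/
lemma IsCogredientParametrix.trans {s t u : ℝ} (hst : s ≤ t) (htu : t ≤ u)
    {L N₁ N₂ : ℝ → H →L[ℝ] H}
    {J₁ J₂ : H →L[ℝ] H} (h₁ : IsCogredientParametrix s t L J₁ N₁)
    (h₂ : IsCogredientParametrix t u L J₂ N₂) : ∃ N, IsCogredientParametrix s u L J₁ N := by
  rw [isCogredientParametrix_iff] at h₁ h₂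
  obtain ⟨c₁, u₁, k₁⟩ := h₁
  obtain ⟨c₂, u₂, k₂⟩ := h₂
  have ht₁ : t ∈ Icc s t := ⟨hst, le_rfl⟩
  have ht₂ : t ∈ Icc t u := ⟨le_rfl, htu⟩
  have hmin : ∀ r ∈ Icc s u, min r t ∈ Icc s t := fun r hr => ⟨le_min hr.1 hst, min_le_right _ _⟩
  have hmax : ∀ r ∈ Icc s u, max r t ∈ Icc t u := fun r hr => ⟨le_max_right _ _, max_le hr.2 htu⟩
  -- The constant factor `N₂(t)⁻¹ N₁(t)` makes the second piece match the first at `t`; `max` and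
  -- `min` freeze each piece outside its interval.
  refine ⟨fun r => N₂ (max r t) * (Ring.inverse (N₂ t) * N₁ (min r t)),
    isCogredientParametrix_iff.2 ⟨?_, fun r hr => ?_, fun r hr => ?_⟩⟩
  · exact (c₂.comp (by fun_prop) hmax).mul (continuousOn_const.mul (c₁.comp (by fun_prop) hmin))
  · exact (u₂ _ (hmax r hr)).mul ((u₂ t ht₂).ringInverse.mul (u₁ _ (hmin r hr)))
  · rcases le_total r t with h | h
    · simp only [max_eq_right h, min_eq_left h]
      rw [← mul_assoc (N₂ t), Ring.mul_inverse_cancel _ (u₂ t ht₂), one_mul]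
      exact k₁ r ⟨hr.1, h⟩
    · simp only [max_eq_left h, min_eq_right h]
      set U := Ring.inverse (N₂ t) * N₁ t with hU
      have hNU : N₂ t * U = N₁ t := by
        rw [hU, ← mul_assoc, Ring.mul_inverse_cancel _ (u₂ t ht₂), one_mul]
      -- `U* J₂ U` and `J₁` differ by a compact operator, since both agree with `N₁(t)* L_t N₁(t)`
      -- modulo compacts.
      have e1 : star (N₂ r * U) * L r * (N₂ r * U) - J₁ =
          (star U * (star (N₂ r) * L r * N₂ r) * U - star U * J₂ * U) -
          (star U * (star (N₂ t) * L t * N₂ t) * U - star U * J₂ * U) +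
          (star (N₁ t) * L t * N₁ t - J₁) := by
        have e2 : star (N₁ t) * L t * N₁ t = star U * (star (N₂ t) * L t * N₂ t) * U := by
          rw [← hNU, star_mul]; simp only [mul_assoc]
        rw [e2, star_mul]; noncomm_ring
      rw [e1]
      exact ((isCompactOperator_conj_sub (k₂ r ⟨h, hr.2⟩)).sub
        (isCompactOperator_conj_sub (k₂ t ht₂))).add (k₁ t ht₁)

/-- Every path of self-adjoint Fredholm operators has a cogredient parametrix. -/
lemma exists_isCogredientParametrix {a b : ℝ} (hab : a ≤ b) {L : ℝ → H →L[ℝ] H}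
    (hLc : ContinuousOn L (Icc a b)) (hL : ∀ t ∈ Icc a b, L t ∈ selfAdjointFredholm H) :
    ∃ J N, IsSymmetry J ∧ IsCogredientParametrix a b L J N := by
  have hex := fun t : Icc a b => exists_cogredient_symmetry_of_fredholm (hL t t.2)
  choose J N hJ hN hK using hex
  let E : Icc a b → ℝ → H →L[ℝ] H := fun i r => star (N i) * (L r - L i) * N i
  have hE : ∀ i, ContinuousOn (E i) (Icc a b) := fun i => by
    simp only [E]; fun_prop
  have hopen : ∀ i, IsOpen {r : Icc a b | ‖E i r‖ < 1} := fun i =>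
    isOpen_lt (continuousOn_iff_continuous_domRestrict.1 (hE i)).norm continuous_const
  have hcover : (univ : Set (Icc a b)) ⊆ ⋃ i, {r : Icc a b | ‖E i r‖ < 1} := fun r _ =>
    mem_iUnion.2 ⟨r, by simp [E]⟩
  -- On each piece of a fine subdivision, `L` stays close enough to one value `L i` for
  -- `symCorrection` to turn the constant `N i` into a parametrix.
  obtain ⟨t, ht0, hmono, ⟨m, hm⟩, hsub⟩ :=
    exists_monotone_Icc_subset_open_cover_Icc hab hopen hcover
  have hstep : ∀ n, ∃ J' N', IsSymmetry J' ∧ IsCogredientParametrix (t n) (t (n + 1)) L J' N' := by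
    intro n
    obtain ⟨i, hi⟩ := hsub n
    have hIcc : Icc (t n : ℝ) (t (n + 1)) ⊆ Icc a b := Icc_subset_Icc (t n).2.1 (t (n + 1)).2.2
    have hlt : ∀ r ∈ Icc (t n : ℝ) (t (n + 1)), ‖E i r‖ < 1 := fun r hr =>
      hi (a := ⟨r, hIcc hr⟩) ⟨hr.1, hr.2⟩
    refine ⟨J i, fun r => N i * symCorrection (J i) (E i r), hJ i,
      isCogredientParametrix_iff.2 ⟨fun r hr => ?_, fun r hr => ?_, fun r hr => ?_⟩⟩
    · exact continuousWithinAt_const.mul (((hJ i).continuousAt_symCorrection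
        (hlt r hr)).comp_continuousWithinAt ((hE i).mono hIcc r hr))
    · exact (hN i).mul ((hJ i).isUnit_symCorrection (hlt r hr))
    · have := isCompactOperator_symCorrection (hJ i) (hK i) ((hL r (hIcc hr)).1.sub (hL i i.2).1)
        (hlt r hr)
      rwa [add_sub_cancel] at this
  have hall : ∀ n, ∃ J' N', IsSymmetry J' ∧ IsCogredientParametrix a (t n) L J' N' := by
    intro n
    induction n with
    | zero =>
      obtain ⟨J', N', hJ', h'⟩ := hstep 0
      -- As `t 0 = a`, this interval is the single point `a`.
      have hsub0 : Icc a (t 0 : ℝ) ⊆ Icc (t 0 : ℝ) (t 1) := by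
        rw [ht0]
        rintro r ⟨h1, h2⟩
        exact ⟨h1, h2.trans ((t 1).2.1)⟩
      exact ⟨J', N', hJ', h'.1.mono hsub0, fun r hr => h'.2 r (hsub0 hr),
        fun r hr => h'.3 r (hsub0 hr)⟩
    | succ n ih =>
      obtain ⟨J₁, N₁, hJ₁, h₁⟩ := ih
      obtain ⟨J₂, N₂, -, h₂⟩ := hstep n
      obtain ⟨N', h'⟩ := h₁.trans (t n).2.1 (hmono n.le_succ) h₂
      exact ⟨J₁, N', hJ₁, h'⟩
  have := hall m
  rwa [hm m le_rfl] at this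

end Parametrix

/-! ### Well-definedness of the spectral flow and comparison of admissible paths. -/

section SpectralFlowComparison

open Filter ContinuousLinearMap

variable {H : Type*} [NormedAddCommGroup H] [InnerProductSpace ℝ H] [CompleteSpace H]

lemma hasAdmissibleSpectralFlow_iff {a b : ℝ} {L : ℝ → H →L[ℝ] H} {n : ℤ} :
    HasAdmissibleSpectralFlow a b L n ↔ IsUnit (L a) ∧ IsUnit (L b) ∧
      ∃ J N : _, IsSymmetry J ∧ IsCogredientParametrix a b L J N ∧
        n = relMorseIndex (star (N a) * L a * N a) (star (N b) * L b * N b) := by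
  constructor
  · rintro ⟨ha, hb, J, N, h1, h2, h3, h4⟩
    exact ⟨ha, hb, J, N, ⟨h1, h2⟩, h3, h4⟩
  · rintro ⟨ha, hb, J, N, h1, h3, h4⟩
    exact ⟨ha, hb, J, N, h1.1, h1.2, h3, h4⟩

/-- The spectral flow of an admissible path does not depend on the parametrix. -/
lemma HasAdmissibleSpectralFlow.unique {a b : ℝ} (hab : a ≤ b) {L : ℝ → H →L[ℝ] H}
    (hLa : IsSelfAdjoint (L a)) (hLb : IsSelfAdjoint (L b)) {n n' : ℤ}
    (h : HasAdmissibleSpectralFlow a b L n) (h' : HasAdmissibleSpectralFlow a b L n') :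
    n = n' := by
  rw [hasAdmissibleSpectralFlow_iff] at h h'
  obtain ⟨hua, hub, J, N, hJ, hN, rfl⟩ := h
  obtain ⟨-, -, J', N', hJ', hN', rfl⟩ := h'
  obtain ⟨c, u, k⟩ := isCogredientParametrix_iff.1 hN
  obtain ⟨c', u', k'⟩ := isCogredientParametrix_iff.1 hN'
  have ha : a ∈ Icc a b := left_mem_Icc.2 hab
  have hb : b ∈ Icc a b := right_mem_Icc.2 hab
  set U : ℝ → H →L[ℝ] H := fun t => Ring.inverse (N t) * N' t with hU
  have hUc : ContinuousOn U (Icc a b) := (continuousOn_inverse c u).mul c'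
  have hUu : ∀ t ∈ Icc a b, IsUnit (U t) := fun t ht => (u t ht).ringInverse.mul (u' t ht)
  have hNU : ∀ t ∈ Icc a b, N t * U t = N' t := fun t ht => by
    rw [hU]
    simp only
    rw [← mul_assoc, Ring.mul_inverse_cancel _ (u t ht), one_mul]
  have hconj : ∀ t ∈ Icc a b, star (N' t) * L t * N' t =
      star (U t) * (star (N t) * L t * N t) * U t := fun t ht => by
    rw [← hNU t ht, star_mul]; simp only [mul_assoc]
  rw [hconj a ha, hconj b hb]
  set A := star (N a) * L a * N a with hA
  set B := star (N b) * L b * N b with hB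
  have hAs : IsSelfAdjoint A := hLa.conjugate' _
  have hBs : IsSelfAdjoint B := hLb.conjugate' _
  have hAu : IsUnit A := isUnit_conj (u a ha) hua
  have hBu : IsUnit B := isUnit_conj (u b hb) hub
  have hUA : ∀ t ∈ Icc a b, IsCompactOperator (star (U t) * A * U t - J') := by
    intro t ht
    have h1 := (isCompactOperator_conj_sub (U := U t)
      (isCompactOperator_sub_of_sub (k a ha) (k t ht))).add (hconj t ht ▸ k' t ht)
    rwa [← FunLike.coe_add, sub_add_sub_cancel] at h1
  have hUB : IsCompactOperator (star (U b) * B * U b - J') := hconj b hb ▸ k' b hb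
  -- At the two ends the second parametrix involves different operators `U a` and `U b`. Moving `U
  -- t` in the first argument, within `J'` + compact, makes them equal, so that cogredience
  -- invariance applies.
  have key := relMorseIndex_eq_of_isPreconnected (isPreconnected_Icc (a := a) (b := b))
    (S := fun t => star (U t) * A * U t) (T := fun _ => star (U b) * B * U b)
    (by fun_prop) continuousOn_const
    (fun t _ => hAs.conjugate' _) (fun _ _ => hBs.conjugate' _)
    (fun t ht => isUnit_conj (hUu t ht) hAu) (fun _ _ => isUnit_conj (hUu b hb) hBu)
    (fun t ht => isCompactOperator_sub_of_sub (hUA t ht) hUB) ha hb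
  rw [key]
  exact (relMorseIndex_conj hAs hAu hBs hBu
    (isCompactOperator_sub_of_sub (k a ha) (k b hb)) (hUu b hb)).symm

lemma isSelfAdjoint_add_smul_id {T : H →L[ℝ] H} (hT : IsSelfAdjoint T) (δ : ℝ) :
    IsSelfAdjoint (T + δ • ContinuousLinearMap.id ℝ H) := by
  change IsSelfAdjoint (T + δ • (1 : H →L[ℝ] H))
  simp [IsSelfAdjoint, hT.star_eq]

/-- The spectral flow of a path of self-adjoint Fredholm operators exists. -/
lemma exists_hasSpectralFlow {a b : ℝ} (hab : a ≤ b) {L : ℝ → H →L[ℝ] H}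
    (hLc : ContinuousOn L (Icc a b)) (hL : ∀ t ∈ Icc a b, L t ∈ selfAdjointFredholm H) :
    ∃ n, HasSpectralFlow a b L n := by
  obtain ⟨J, N, hJ, hN⟩ := exists_isCogredientParametrix hab hLc hL
  obtain ⟨c, u, k⟩ := isCogredientParametrix_iff.1 hN
  have ha : a ∈ Icc a b := left_mem_Icc.2 hab
  have hb : b ∈ Icc a b := right_mem_Icc.2 hab
  let E : ℝ → ℝ → H →L[ℝ] H := fun δ t => star (N t) * (δ • (1 : H →L[ℝ] H)) * N t
  let m : ℝ → ℝ → H →L[ℝ] H := fun δ t => N t * symCorrection J (E δ t)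
  obtain ⟨C, hC⟩ := isCompact_Icc.exists_bound_of_continuousOn c
  -- With `‖N t‖ ≤ C`, this range of `δ` gives `‖δ N* N‖ < 1` for all `t` at once; the `+ 1` avoids
  -- division by zero.
  have hE : ∀ δ ∈ Ioo (0 : ℝ) (1 / (C ^ 2 + 1)), ∀ t ∈ Icc a b, ‖E δ t‖ < 1 := by
    intro δ hδ t ht
    have e : E δ t = δ • (star (N t) * N t) := by
      simp only [E, mul_smul_comm, smul_mul_assoc, mul_one]
    have h1 : ‖star (N t) * N t‖ ≤ ‖N t‖ * ‖N t‖ := by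
      exact (norm_mul_le _ _).trans_eq (congrArg (· * ‖N t‖) (norm_star (N t)))
    have h2 : ‖N t‖ * ‖N t‖ ≤ C ^ 2 := by
      rw [sq]
      exact mul_self_le_mul_self (norm_nonneg _) (hC t ht)
    have h3 := (lt_div_iff₀ (by positivity : 0 < C ^ 2 + 1)).1 hδ.2
    rw [e, norm_smul, Real.norm_eq_abs, abs_of_pos hδ.1]
    nlinarith [hδ.1, mul_le_mul_of_nonneg_left (h1.trans h2) hδ.1.le]
  have hunits := (eventually_isUnit_add_smul (hL a ha)).and (eventually_isUnit_add_smul (hL b hb))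
  obtain ⟨r, hr, hru⟩ := mem_nhdsGT_iff_exists_Ioo_subset.1 hunits
  have hr : 0 < r := hr
  set δ₀ := min r (1 / (C ^ 2 + 1))
  have hδ₀ : 0 < δ₀ := lt_min hr (by positivity)
  have hs₁ : ∀ δ ∈ Ioo 0 δ₀, δ ∈ Ioo (0 : ℝ) (1 / (C ^ 2 + 1)) := fun δ hδ =>
    ⟨hδ.1, hδ.2.trans_le (min_le_right _ _)⟩
  have hs₂ : ∀ δ ∈ Ioo 0 δ₀, IsUnit (L a + δ • ContinuousLinearMap.id ℝ H) ∧
      IsUnit (L b + δ • ContinuousLinearMap.id ℝ H) := fun δ hδ =>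
    hru ⟨hδ.1, hδ.2.trans_le (min_le_left _ _)⟩
  let A : ℝ → ℝ → H →L[ℝ] H := fun t δ =>
    star (m δ t) * (L t + δ • ContinuousLinearMap.id ℝ H) * m δ t
  have hmu : ∀ δ ∈ Ioo 0 δ₀, ∀ t ∈ Icc a b, IsUnit (m δ t) := fun δ hδ t ht =>
    (u t ht).mul (hJ.isUnit_symCorrection (hE δ (hs₁ δ hδ) t ht))
  have hAs : ∀ t ∈ Icc a b, ∀ δ ∈ Ioo 0 δ₀, IsSelfAdjoint (A t δ) := fun t ht δ _ =>
    (isSelfAdjoint_add_smul_id (hL t ht).1 δ).conjugate' _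
  have hAK : ∀ t ∈ Icc a b, ∀ δ ∈ Ioo 0 δ₀, IsCompactOperator (A t δ - J) := fun t ht δ hδ =>
    isCompactOperator_symCorrection hJ (k t ht)
      (by simp [IsSelfAdjoint]) (hE δ (hs₁ δ hδ) t ht)
  have hAc : ∀ t ∈ Icc a b, ContinuousOn (A t) (Ioo 0 δ₀) := by
    intro t ht
    have hm : ContinuousOn (fun δ => m δ t) (Ioo 0 δ₀) := fun δ hδ => by
      have hEc : Continuous fun δ => E δ t := by simp only [E]; fun_prop
      exact continuousWithinAt_const.mul ((hJ.continuousAt_symCorrection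
        (hE δ (hs₁ δ hδ) t ht)).comp_continuousWithinAt (f := fun δ => E δ t)
          hEc.continuousWithinAt)
    simp only [A]
    fun_prop
  -- The end-points stay invertible for all `δ` in the connected interval `(0, δ₀)`, so homotopy
  -- invariance in `δ` yields a single integer.
  have hconst := fun {x y : ℝ} (hx : x ∈ Ioo 0 δ₀) (hy : y ∈ Ioo 0 δ₀) =>
    relMorseIndex_eq_of_isPreconnected isPreconnected_Ioo (hAc a ha) (hAc b hb) (hAs a ha)
      (hAs b hb) (fun δ hδ => isUnit_conj (hmu δ hδ a ha) (hs₂ δ hδ).1)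
      (fun δ hδ => isUnit_conj (hmu δ hδ b hb) (hs₂ δ hδ).2)
      (fun δ hδ => isCompactOperator_sub_of_sub (hAK a ha δ hδ) (hAK b hb δ hδ)) hx hy
  have hmid : δ₀ / 2 ∈ Ioo 0 δ₀ := ⟨by positivity, by linarith⟩
  refine ⟨relMorseIndex (A a (δ₀ / 2)) (A b (δ₀ / 2)), ?_⟩
  filter_upwards [Ioo_mem_nhdsGT hδ₀] with δ hδ
  refine hasAdmissibleSpectralFlow_iff.2 ⟨(hs₂ δ hδ).1, (hs₂ δ hδ).2, J, m δ, hJ,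
    isCogredientParametrix_iff.2 ⟨fun t ht => ?_, hmu δ hδ, fun t ht => hAK t ht δ hδ⟩,
    hconst hmid hδ⟩
  have hEc : ContinuousOn (E δ) (Icc a b) := by simp only [E]; fun_prop
  exact (c t ht).mul ((hJ.continuousAt_symCorrection
    (hE δ (hs₁ δ hδ) t ht)).comp_continuousWithinAt (hEc t ht))

lemma HasSpectralFlow.unique {a b : ℝ} (hab : a ≤ b) {L : ℝ → H →L[ℝ] H}
    (hLa : IsSelfAdjoint (L a)) (hLb : IsSelfAdjoint (L b)) {n n' : ℤ}
    (h : HasSpectralFlow a b L n) (h' : HasSpectralFlow a b L n') : n = n' := by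
  obtain ⟨δ, h1, h2⟩ := (h.and h').exists
  exact HasAdmissibleSpectralFlow.unique (L := fun t => L t + δ • ContinuousLinearMap.id ℝ H) hab
    (isSelfAdjoint_add_smul_id hLa δ) (isSelfAdjoint_add_smul_id hLb δ) h1 h2

lemma HasSpectralFlow.spectralFlow_eq {a b : ℝ} (hab : a ≤ b) {L : ℝ → H →L[ℝ] H}
    (hLa : IsSelfAdjoint (L a)) (hLb : IsSelfAdjoint (L b)) {n : ℤ}
    (h : HasSpectralFlow a b L n) : spectralFlow a b L = n :=
  HasSpectralFlow.unique hab hLa hLb (Classical.epsilon_spec (p := HasSpectralFlow a b L) ⟨n, h⟩) h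

lemma conj_le_conj {S T N : H →L[ℝ] H} (h : S ≤ T) :
    star N * S * N ≤ star N * T * N := by
  rw [ContinuousLinearMap.le_def] at *
  have e : star N * T * N - star N * S * N = adjoint N ∘L (T - S) ∘L N := by
    rw [← star_eq_adjoint]
    change _ = star N * ((T - S) * N)
    noncomm_ring
  rw [e]
  exact h.adjoint_conj N

/-- Comparison of the spectral flows of two admissible paths with compact difference. -/
lemma HasAdmissibleSpectralFlow.le {a b : ℝ} (hab : a ≤ b) {L M : ℝ → H →L[ℝ] H}
    (hL : ∀ t ∈ Icc a b, IsSelfAdjoint (L t)) (hM : ∀ t ∈ Icc a b, IsSelfAdjoint (M t))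
    (hcompact : ∀ t ∈ Icc a b, IsCompactOperator (L t - M t)) (ha : L a ≤ M a) (hb : M b ≤ L b)
    {m n : ℤ} (hm : HasAdmissibleSpectralFlow a b M m) (hn : HasAdmissibleSpectralFlow a b L n) :
    m ≤ n := by
  have hma : a ∈ Icc a b := left_mem_Icc.2 hab
  have hmb : b ∈ Icc a b := right_mem_Icc.2 hab
  have hmu := hm.1
  have hmu' := hm.2.1
  rw [hasAdmissibleSpectralFlow_iff] at hn
  obtain ⟨hua, hub, J, N, hJ, hN, rfl⟩ := hn
  obtain ⟨c, u, k⟩ := isCogredientParametrix_iff.1 hN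
  have kM : ∀ t ∈ Icc a b, IsCompactOperator (star (N t) * M t * N t - J) := by
    intro t ht
    have h1 := (k t ht).sub (isCompactOperator_conj_sub (U := N t) (hcompact t ht))
    rwa [← FunLike.coe_sub, sub_sub_sub_cancel_left, ← neg_sub, neg_sub] at h1
  have hm' : HasAdmissibleSpectralFlow a b M
      (relMorseIndex (star (N a) * M a * N a) (star (N b) * M b * N b)) :=
    hasAdmissibleSpectralFlow_iff.2
      ⟨hmu, hmu', J, N, hJ, isCogredientParametrix_iff.2 ⟨c, u, kM⟩, rfl⟩
  rw [hm.unique hab (hM a hma) (hM b hmb) hm']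
  have sLa := (hL a hma).conjugate' (N a)
  have sMa := (hM a hma).conjugate' (N a)
  have sLb := (hL b hmb).conjugate' (N b)
  have sMb := (hM b hmb).conjugate' (N b)
  have uLa := isUnit_conj (u a hma) hua
  have uMa := isUnit_conj (u a hma) hmu
  have uLb := isUnit_conj (u b hmb) hub
  have uMb := isUnit_conj (u b hmb) hmu'
  have i1 := relMorseIndex_nonneg sLa uLa sMa uMa (conj_le_conj ha)
  have i2 := relMorseIndex_nonneg sMb uMb sLb uLb (conj_le_conj hb)
  -- The index is split along the route from `L a` through `M a` and `M b` to `L b`, after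
  -- conjugation by `N`.
  have c1 := relMorseIndex_add_relMorseIndex hJ sLa uLa (k a hma) sMa uMa (kM a hma) sMb uMb
    (kM b hmb)
  have c2 := relMorseIndex_add_relMorseIndex hJ sLa uLa (k a hma) sMb uMb (kM b hmb) sLb uLb
    (k b hmb)
  omega

end SpectralFlowComparison

/-! ### The comparison theorem. -/

theorem corollary6p2 {H : Type*} [NormedAddCommGroup H] [InnerProductSpace ℝ H] [CompleteSpace H]
    [TopologicalSpace.SeparableSpace H] (a b : ℝ) (hab : a ≤ b) (L M : ℝ → H →L[ℝ] H)
    (hLcont : ContinuousOn L (Icc a b)) (hL : ∀ t ∈ Icc a b, L t ∈ selfAdjointFredholm H)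
    (hMcont : ContinuousOn M (Icc a b)) (hM : ∀ t ∈ Icc a b, M t ∈ selfAdjointFredholm H)
    (hcompact : ∀ t ∈ Icc a b, IsCompactOperator (L t - M t))
    (ha : L a ≤ M a) (hb : M b ≤ L b) :
    (∃! m : ℤ, HasSpectralFlow a b M m) ∧ (∃! n : ℤ, HasSpectralFlow a b L n) ∧
      spectralFlow a b M ≤ spectralFlow a b L := by
  have hma : a ∈ Icc a b := left_mem_Icc.2 hab
  have hmb : b ∈ Icc a b := right_mem_Icc.2 hab
  obtain ⟨m, hm⟩ := exists_hasSpectralFlow hab hMcont hM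
  obtain ⟨n, hn⟩ := exists_hasSpectralFlow hab hLcont hL
  refine ⟨⟨m, hm, fun _ h => h.unique hab (hM a hma).1 (hM b hmb).1 hm⟩,
    ⟨n, hn, fun _ h => h.unique hab (hL a hma).1 (hL b hmb).1 hn⟩, ?_⟩
  rw [hm.spectralFlow_eq hab (hM a hma).1 (hM b hmb).1,
    hn.spectralFlow_eq hab (hL a hma).1 (hL b hmb).1]
  -- One common `δ` for both paths leaves their difference, and hence compactness and the end-point
  -- inequalities, unchanged.
  obtain ⟨δ, h1, h2⟩ := (hm.and hn).exists
  refine HasAdmissibleSpectralFlow.le hab (fun t ht => isSelfAdjoint_add_smul_id (hL t ht).1 δ)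
    (fun t ht => isSelfAdjoint_add_smul_id (hM t ht).1 δ) (fun t ht => ?_) ?_ ?_ h1 h2
  · rw [add_sub_add_right_eq_sub]
    exact hcompact t ht
  · rw [ContinuousLinearMap.le_def, add_sub_add_right_eq_sub]
    exact (ContinuousLinearMap.le_def _ _).1 ha
  · rw [ContinuousLinearMap.le_def, add_sub_add_right_eq_sub]
    exact (ContinuousLinearMap.le_def _ _).1 hb
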